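/- Let $k$ be an arbitrary field. Conventions. For a quadratic space $(V,q)$ over $k$ put $\beta(x,y)=q(x+y)-q(x)-q(y)$. The space is \emph{regular} if it is finite dimensional and either $\beta$ is nondegenerate, or $\dim V$ is odd, $\mathrm{char}\,k=2$, $\ker\beta$ is a line and $q$ is not identically $0$ on it. Let $\mathrm C(V)$ be the Clifford algebra and $\mathrm C(V)_0$ its even part. $\mathrm{GSpin}(V)$ is the group of $g\in \mathrm C(V)_0^\times$ with $gVg^{-1}=V$, and $\mathrm{Spin}(V)$ is the subgroup of the $g$ with $g\,g^{t}=1$, where $x\mapsto x^t$ is the anti-involution of $\mathrm C(V)$ fixing $V$ pointwise. An \emph{octonion $k$-algebra} is an $8$-dimensional nondegenerate quadratic space $(C,q)$ with a bilinear product such that $q(xy)=q(x)q(y)$ and a two-sided unit $e$. Put $\bar x=\beta(x,e)e-x$, let $P=e^{\perp}$ be the quadratic space of pure octonions, and let $\mathrm G_2(C)$ be the group of automorphisms of the $k$-algebra $C$. The maps $\ell(x):(a,b)\mapsto (xb,\bar x a)$ extend to an algebra isomorphism $\ell_C:\mathrm C(C)\to \mathrm{End}(C\oplus C)$. If $V$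 is a quadratic space and $f:V\hookrightarrow C$ an isometric embedding with image $P$, let $b:\mathrm C(V)\to \mathrm C(C)$ be the induced map. Write $\widetilde{\jmath}_{C}:\mathrm G_2(C)\to \mathrm{Spin}(V)$ for the morphism sending $\varphi$ to the unique $\gamma\in\mathrm{Spin}(V)$ with $\ell_C(b(\gamma))=\varphi\oplus\varphi$. A \emph{$\mathrm G_2$-subgroup} of $\mathrm{Spin}(V)$ is a subgroup of the form $\widetilde{\jmath}_C(\mathrm G_2(C))$ for some such $C$ and $f$. For $V=P$ and $f$ the inclusion, let $\rho_C$ be the action of $\mathrm C(P)_0$ on $C=C\oplus 0$ through $\ell_C\circ b$; this makes $C$ a spinor module for $P$. (1) Let $C$ be an octonion $k$-algebra with space of pure octonions $P$, and let $\Gamma\subset \mathrm{Spin}(P)$ be a subgroup acting semisimply on $C$ through $\rho_C$. The following are equivalent: (a) for each $\gamma\in\Gamma$ there is $g\in\mathrm{GSpin}(P)$ with $g\gamma g^{-1}\in\widetilde{\jmath}_C(\mathrm G_2(C))$; (b) for each $\gamma\in\Gamma$ there is $s\in C$ with $q(s)\neq0$ and $\rho_C(\gamma)s=s$; (c) for each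 $\gamma\in\Gamma$, $1$ is an eigenvalue of $\rho_C(\gamma)$; (d) there is $g\in\mathrm{GSpin}(P)$ with $g\Gamma g^{-1}\subset\widetilde{\jmath}_C(\mathrm G_2(C))$; (e) there is $s\in C$ with $q(s)\neq0$ and $\rho_C(\gamma)s=s$ for all $\gamma\in\Gamma$. (2) Let $P$ be a regular quadratic space of dimension $7$ over $k$ such that $\mathrm{Spin}(P)$ has a $\mathrm G_2$-subgroup, let $W$ be a spinor module for $P$ (a simple $\mathrm C(P)_0$-module), and let $\Gamma\subset\mathrm{Spin}(P)$ be a subgroup acting semisimply on $W$. The following are equivalent: (i) each element of $\Gamma$ belongs to some $\mathrm G_2$-subgroup of $\mathrm{Spin}(P)$; (ii) each element of $\Gamma$ has the eigenvalue $1$ in $W$; (iii) $\Gamma$ is contained in some $\mathrm G_2$-subgroup of $\mathrm{Spin}(P)$. -/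

import Mathlib

universe u v w

/-! ### Quadratic spaces, general spin groups, spin groups -/

section Quadratic

variable {k : Type u} [Field k] {V : Type v} [AddCommGroup V] [Module k V]

/-- A quadratic space `(V, Q)` over `k` is regular if either its polar bilinear form is
nondegenerate, or `dim V` is odd, `k` has characteristic `2`, the kernel of the polar form is a line
and `Q` is not identically zero on this line. -/
def IsRegularQuadraticForm (Q : QuadraticForm k V) : Prop :=
  FiniteDimensional k V ∧
    (Q.polarBilin.Nondegenerate ∨
      (Odd (Module.finrank k V) ∧ CharP k 2 ∧
        Module.finrank k (LinearMap.ker Q.polarBilin) = 1 ∧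
        ∃ x ∈ LinearMap.ker Q.polarBilin, Q x ≠ 0))

/-- `GSpin(V)`: the invertible elements of the even Clifford algebra that normalize
`V ⊆ C(V)`. -/
def GSpinGroup (Q : QuadraticForm k V) : Subgroup (CliffordAlgebra.even Q)ˣ where
  carrier := {g | ∀ x : V,
    (∃ y : V, ((g : CliffordAlgebra.even Q) : CliffordAlgebra Q) * CliffordAlgebra.ι Q x *
      ((g⁻¹ : (CliffordAlgebra.even Q)ˣ) : CliffordAlgebra.even Q) = CliffordAlgebra.ι Q y) ∧
    (∃ y : V, (((g⁻¹ : (CliffordAlgebra.even Q)ˣ) : CliffordAlgebra.even Q) : CliffordAlgebra Q) *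
      CliffordAlgebra.ι Q x * (g : CliffordAlgebra.even Q) = CliffordAlgebra.ι Q y)}
  one_mem' := fun x => by simp
  mul_mem' := by
    intro a b ha hb x
    constructor
    · obtain ⟨y, hy⟩ := (hb x).1
      obtain ⟨z, hz⟩ := (ha y).1
      refine ⟨z, ?_⟩
      rw [← hz, ← hy]
      simp [mul_assoc]
    · obtain ⟨y, hy⟩ := (ha x).2
      obtain ⟨z, hz⟩ := (hb y).2
      refine ⟨z, ?_⟩
      rw [← hz, ← hy]
      simp [mul_assoc]
  inv_mem' := by
    intro a ha x
    have h := ha x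
    rw [inv_inv]
    exact ⟨h.2, h.1⟩

/-- `Spin(V)`: the elements `g` of `GSpin(V)` with `g gᵗ = 1`, where `x ↦ xᵗ` is the
anti-involution of `C(V)` that fixes `V` pointwise (`CliffordAlgebra.reverse`). -/
def SpinGroup (Q : QuadraticForm k V) : Subgroup (CliffordAlgebra.even Q)ˣ where
  carrier := {g | g ∈ GSpinGroup Q ∧
    ((g : CliffordAlgebra.even Q) : CliffordAlgebra Q) *
      CliffordAlgebra.reverse ((g : CliffordAlgebra.even Q) : CliffordAlgebra Q) = 1}
  one_mem' := ⟨one_mem _, by simp⟩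
  mul_mem' := by
    rintro a b ⟨ha, ha'⟩ ⟨hb, hb'⟩
    refine ⟨mul_mem ha hb, ?_⟩
    simp only [Units.val_mul, MulMemClass.coe_mul, CliffordAlgebra.reverse.map_mul]
    rw [mul_assoc, ← mul_assoc ((b : CliffordAlgebra.even Q) : CliffordAlgebra Q), hb', one_mul,
      ha']
  inv_mem' := by
    rintro a ⟨ha, ha'⟩
    refine ⟨inv_mem ha, ?_⟩
    have h1 : (((a⁻¹ : (CliffordAlgebra.even Q)ˣ) : CliffordAlgebra.even Q) : CliffordAlgebra Q) *
        ((a : CliffordAlgebra.even Q) : CliffordAlgebra Q) = 1 := by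
      rw [← MulMemClass.coe_mul, Units.inv_mul]; rfl
    have h2 : CliffordAlgebra.reverse
        ((a : CliffordAlgebra.even Q) : CliffordAlgebra Q) *
        CliffordAlgebra.reverse
        (((a⁻¹ : (CliffordAlgebra.even Q)ˣ) : CliffordAlgebra.even Q) : CliffordAlgebra Q) = 1 := by
      rw [← CliffordAlgebra.reverse.map_mul, h1, CliffordAlgebra.reverse.map_one]
    have h3 : (((a⁻¹ : (CliffordAlgebra.even Q)ˣ) : CliffordAlgebra.even Q) : CliffordAlgebra Q) =
        CliffordAlgebra.reverse ((a : CliffordAlgebra.even Q) : CliffordAlgebra Q) := by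
      calc _ = _ * (((a : CliffordAlgebra.even Q) : CliffordAlgebra Q) *
            CliffordAlgebra.reverse ((a : CliffordAlgebra.even Q) : CliffordAlgebra Q)) := by
            rw [ha', mul_one]
        _ = _ := by rw [← mul_assoc, h1, one_mul]
    rw [h3] at h2 ⊢
    exact h2

/-- The linear representation on `W` of a group `Γ` of units of the even Clifford algebra, obtained
by restricting a representation of the even Clifford algebra on `W`. -/
def cliffordUnitsRep {Q : QuadraticForm k V} {W : Type w} [AddCommGroup W] [Module k W]
    (f : CliffordAlgebra.even Q →ₐ[k] Module.End k W)
    (Γ : Subgroup (CliffordAlgebra.even Q)ˣ) : Representation k Γ W :=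
  ((f : CliffordAlgebra.even Q →* Module.End k W).comp (Units.coeHom _)).comp Γ.subtype

end Quadratic

/-! ### Octonion algebras -/

/-- An octonion `k`-algebra structure on the vector space `C`: a nondegenerate quadratic form `q` on
`C`, of dimension `8`, with a bilinear product that is multiplicative for `q` and has a two-sided
unit element `e`. -/
structure OctonionAlgebra (k : Type u) (C : Type v) [Field k] [AddCommGroup C] [Module k C] where
  q : QuadraticForm k C
  mul : C →ₗ[k] C →ₗ[k] C
  e : C
  finrank_eq : Module.finrank k C = 8
  nondegenerate : q.polarBilin.Nondegenerate
  q_mul : ∀ x y : C, q (mul x y) = q x * q y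
  e_mul : ∀ x : C, mul e x = x
  mul_e : ∀ x : C, mul x e = x

namespace OctonionAlgebra

variable {k : Type u} [Field k] {C : Type v} [AddCommGroup C] [Module k C]

/-- The polar form `β(x, y) = q(x + y) - q(x) - q(y)`. -/
def β (O : OctonionAlgebra k C) (x y : C) : k := O.q.polarBilin x y

/-- The canonical involution `x ↦ x̄ = β(x, e) e - x`. -/
def conj (O : OctonionAlgebra k C) : C →ₗ[k] C :=
  (O.q.polarBilin.flip O.e).smulRight O.e - LinearMap.id

theorem conj_apply (O : OctonionAlgebra k C) (x : C) : O.conj x = O.β x O.e • O.e - x := rfl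

theorem β_def (O : OctonionAlgebra k C) (x y : C) : O.β x y = O.q (x + y) - O.q x - O.q y := rfl

theorem β_comm (O : OctonionAlgebra k C) (x y : C) : O.β x y = O.β y x := by
  rw [β_def, β_def, add_comm]; ring

theorem q_add (O : OctonionAlgebra k C) (x y : C) : O.q (x + y) = O.q x + O.q y + O.β x y := by
  rw [β_def]; ring

theorem q_e (O : OctonionAlgebra k C) : O.q O.e = 1 := by
  have h : ∀ x, O.q x = O.q O.e * O.q x := fun x => by rw [← O.q_mul, O.e_mul]
  by_contra hne
  have h0 : O.q O.e = 0 := by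
    have h1 := h O.e
    by_contra h2
    exact hne (mul_left_cancel₀ h2 (by rw [← h1, mul_one]))
  have hz : ∀ x, O.q x = 0 := fun x => by rw [h x, h0, zero_mul]
  have hx : ∀ x : C, x = 0 := fun x =>
    O.nondegenerate.1 x fun y => by
      change O.β x y = 0
      rw [β_def, hz, hz, hz]; ring
  have : Subsingleton C := ⟨fun a b => by rw [hx a, hx b]⟩
  have h8 := O.finrank_eq
  rw [Module.finrank_zero_of_subsingleton] at h8
  omega

theorem β_mul_left (O : OctonionAlgebra k C) (x y z : C) :
    O.β (O.mul x y) (O.mul x z) = O.q x * O.β y z := by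
  rw [β_def, β_def, ← map_add, O.q_mul, O.q_mul, O.q_mul]; ring

theorem β_add_left (O : OctonionAlgebra k C) (x y z : C) :
    O.β (x + y) z = O.β x z + O.β y z := by simp [β]

theorem β_add_right (O : OctonionAlgebra k C) (x y z : C) :
    O.β x (y + z) = O.β x y + O.β x z := by simp [β]

theorem β_sub_left (O : OctonionAlgebra k C) (x y z : C) :
    O.β (x - y) z = O.β x z - O.β y z := by simp [β]

theorem β_smul_left (O : OctonionAlgebra k C) (r : k) (x z : C) :
    O.β (r • x) z = r * O.β x z := by simp [β]

theorem ext_β (O : OctonionAlgebra k C) {x y : C} (h : ∀ z, O.β x z = O.β y z) : x = y := by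
  rw [← sub_eq_zero]
  exact O.nondegenerate.1 _ fun z => by
    change O.β (x - y) z = 0
    rw [β_sub_left, h, sub_self]

theorem β_e_e (O : OctonionAlgebra k C) : O.β O.e O.e = 2 := by
  have h : O.q (O.e + O.e) = 4 := by
    rw [← two_smul k O.e, QuadraticMap.map_smul, q_e]
    norm_num
  rw [β_def, h, q_e]; norm_num

theorem β_cross (O : OctonionAlgebra k C) (x w y z : C) :
    O.β (O.mul x y) (O.mul w z) + O.β (O.mul w y) (O.mul x z) = O.β x w * O.β y z := by
  have h := O.β_mul_left (x + w) y z
  rw [map_add, LinearMap.add_apply, LinearMap.add_apply, β_add_left, β_add_right, β_add_right,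
    β_mul_left, β_mul_left, q_add] at h
  linear_combination h

theorem β_conj_mul (O : OctonionAlgebra k C) (x y z : C) :
    O.β (O.mul (O.conj x) y) z = O.β y (O.mul x z) := by
  have h := O.β_cross x O.e y z
  rw [O.e_mul, O.e_mul] at h
  rw [conj_apply, map_sub, map_smul, LinearMap.sub_apply, LinearMap.smul_apply, O.e_mul, β_sub_left,
    β_smul_left]
  linear_combination -h

theorem conj_mul_mul (O : OctonionAlgebra k C) (x y : C) :
    O.mul (O.conj x) (O.mul x y) = O.q x • y :=
  O.ext_β fun z => by rw [β_conj_mul, β_mul_left, β_smul_left]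

theorem conj_conj (O : OctonionAlgebra k C) (x : C) : O.conj (O.conj x) = x := by
  rw [conj_apply O (O.conj x), conj_apply, β_sub_left, β_smul_left, β_e_e,
    show O.β x O.e * 2 - O.β x O.e = O.β x O.e by ring]
  abel

theorem q_conj (O : OctonionAlgebra k C) (x : C) : O.q (O.conj x) = O.q x := by
  have h := O.conj_mul_mul x O.e
  have h2 : O.q (O.mul (O.conj x) (O.mul x O.e)) = O.q (O.conj x) * O.q x := by
    rw [O.q_mul, O.mul_e]
  rw [h, QuadraticMap.map_smul, q_e, smul_eq_mul, mul_one] at h2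
  by_cases hx : O.q x = 0
  · have h3 := O.conj_mul_mul (O.conj x) O.e
    have h4 : O.q (O.mul (O.conj (O.conj x)) (O.mul (O.conj x) O.e)) =
        O.q x * O.q (O.conj x) := by rw [O.q_mul, O.mul_e, conj_conj]
    rw [h3, QuadraticMap.map_smul, q_e, smul_eq_mul, mul_one, hx, zero_mul] at h4
    rw [hx]
    exact mul_self_eq_zero.1 h4
  · exact (mul_right_cancel₀ hx h2).symm

theorem mul_conj_mul (O : OctonionAlgebra k C) (x y : C) :
    O.mul x (O.mul (O.conj x) y) = O.q x • y := by
  have h := O.conj_mul_mul (O.conj x) y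
  rwa [conj_conj, q_conj] at h

/-- The space `P` of pure octonions: the orthogonal of `e` for the polar form. -/
def pure (O : OctonionAlgebra k C) : Submodule k C := LinearMap.ker (O.q.polarBilin O.e)

/-- The quadratic form on the space of pure octonions. -/
def pureForm (O : OctonionAlgebra k C) : QuadraticForm k O.pure := O.q.comp O.pure.subtype

/-- The isometric inclusion `P ⊆ C`. -/
def pureIncl (O : OctonionAlgebra k C) : O.pureForm →qᵢ O.q where
  toLinearMap := O.pure.subtype
  map_app' := fun _ => rfl

/-- The odd endomorphism `ℓ(x) : (a, b) ↦ (x b, x̄ a)` of the supervector space `C ⊕ C`. -/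
def ell (O : OctonionAlgebra k C) : C →ₗ[k] Module.End k (C × C) where
  toFun x := ((O.mul x).comp (LinearMap.snd k C C)).prod
    ((O.mul (O.conj x)).comp (LinearMap.fst k C C))
  map_add' x y := by ext <;> simp
  map_smul' r x := by ext <;> simp

@[simp] theorem ell_apply (O : OctonionAlgebra k C) (x : C) (p : C × C) :
    O.ell x p = (O.mul x p.2, O.mul (O.conj x) p.1) := rfl

/-- The spinor module of `C`: the algebra morphism `ℓ_C : C(C) → End(C ⊕ C)` that extends `ℓ`. -/
def ellClifford (O : OctonionAlgebra k C) : CliffordAlgebra O.q →ₐ[k] Module.End k (C × C) :=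
  CliffordAlgebra.lift O.q ⟨O.ell, fun x => by
    refine LinearMap.ext fun p => ?_
    rw [Module.End.mul_apply, ell_apply, ell_apply, mul_conj_mul, conj_mul_mul]
    rfl⟩

/-- `G₂(C)`: the automorphism group of the algebra `C`. -/
def G2 (O : OctonionAlgebra k C) : Subgroup (C ≃ₗ[k] C) where
  carrier := {φ | ∀ x y : C, φ (O.mul x y) = O.mul (φ x) (φ y)}
  one_mem' := fun _ _ => rfl
  mul_mem' := by
    intro φ ψ hφ hψ x y
    simp only [LinearEquiv.mul_apply]
    rw [hψ, hφ]
  inv_mem' := by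
    intro φ hφ x y
    apply φ.injective
    have h : ∀ z, φ ((φ⁻¹ : C ≃ₗ[k] C) z) = z := fun z => φ.apply_symm_apply z
    rw [hφ, h, h, h]

/-- The diagonal morphism `ι_C : G₂(C) → GL(C ⊕ C)`, `φ ↦ ((a, b) ↦ (φ a, φ b))`. -/
def diag (O : OctonionAlgebra k C) : O.G2 →* (Module.End k (C × C))ˣ where
  toFun φ :=
    { val := (φ : C ≃ₗ[k] C).toLinearMap.prodMap (φ : C ≃ₗ[k] C).toLinearMap
      inv := (φ : C ≃ₗ[k] C).symm.toLinearMap.prodMap (φ : C ≃ₗ[k] C).symm.toLinearMap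
      val_inv := by ext <;> simp
      inv_val := by ext <;> simp }
  map_one' := by ext <;> rfl
  map_mul' _ _ := by ext <;> rfl

section Embedding

variable {V : Type w} [AddCommGroup V] [Module k V] {Q : QuadraticForm k V}

/-- The composite `ℓ_C ∘ b : C(V)₀ → End(C ⊕ C)`, where `b` is the morphism of Clifford algebras
induced by an isometric map `f : V → C`. -/
def evenToEnd (O : OctonionAlgebra k C) (f : Q →qᵢ O.q) :
    CliffordAlgebra.even Q →ₐ[k] Module.End k (C × C) :=
  (O.ellClifford.comp (CliffordAlgebra.map f)).comp (CliffordAlgebra.even Q).val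

theorem evenToEnd_snd (O : OctonionAlgebra k C) (f : Q →qᵢ O.q) (g : CliffordAlgebra.even Q)
    (a : C) : (O.evenToEnd f g (a, 0)).2 = 0 := by
  obtain ⟨g, hg⟩ := g
  change (O.ellClifford (CliffordAlgebra.map f g) (a, 0)).2 = 0
  induction g, hg using CliffordAlgebra.even_induction with
  | algebraMap r => simp
  | add x y hx hy ihx ihy => simp [ihx, ihy]
  | ι_mul_ι_mul m₁ m₂ x hx ih => simp [ellClifford] at ih ⊢; simp [ih]

/-- The representation `ρ_C` of `C(V)₀` on the copy `C = C ⊕ 0` (the first half-spinor module of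
`C`), obtained by restriction of `ℓ_C` along `b`. For `f` the inclusion of the pure octonions, this
is the canonical structure of spinor module on `C`. -/
def spinRep (O : OctonionAlgebra k C) (f : Q →qᵢ O.q) :
    CliffordAlgebra.even Q →ₐ[k] Module.End k C :=
  AlgHom.ofLinearMap
    { toFun := fun g => LinearMap.fst k C C ∘ₗ O.evenToEnd f g ∘ₗ LinearMap.inl k C C
      map_add' := fun g h => by ext; simp
      map_smul' := fun r g => by ext; simp }
    (by ext; simp)
    (fun g h => by
      refine LinearMap.ext fun a => ?_
      have hs : O.evenToEnd f h (a, 0) = ((O.evenToEnd f h (a, 0)).1, 0) :=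
        Prod.ext rfl (O.evenToEnd_snd f h a)
      simp only [LinearMap.coe_mk, AddHom.coe_mk, map_mul, LinearMap.comp_apply,
        Module.End.mul_apply, LinearMap.inl_apply, LinearMap.fst_apply]
      rw [hs])

/-- The image in `Spin(V)` of the canonical morphism `b⁻¹ ∘ ℓ_C⁻¹ ∘ ι_C : G₂(C) → Spin(V)`, for an
isometry `f` from `V` onto the space of pure octonions of `C`: the elements `γ` of `Spin(V)` such
that `ℓ_C(b(γ)) = ι_C(φ)` for some `φ` in `G₂(C)`. -/
def g2Image (O : OctonionAlgebra k C) (f : Q →qᵢ O.q) : Subgroup (CliffordAlgebra.even Q)ˣ :=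
  SpinGroup Q ⊓
    O.diag.range.comap (Units.map (O.evenToEnd f : CliffordAlgebra.even Q →* Module.End k (C × C)))

end Embedding

end OctonionAlgebra

/-- `H` is a `G₂`-subgroup of `Spin(V)`: there are an octonion algebra `C` and an isometric embedding
of `V` in `C`, with image the space of pure octonions, such that `H` is the image of `G₂(C)`. -/
def IsG2Subgroup {k : Type u} [Field k] {V : Type v} [AddCommGroup V] [Module k V]
    (Q : QuadraticForm k V) (H : Subgroup (CliffordAlgebra.even Q)ˣ) : Prop :=
  ∃ (C : Type v) (_ : AddCommGroup C) (_ : Module k C) (O : OctonionAlgebra k C) (f : Q →qᵢ O.q),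
    Function.Injective f ∧ LinearMap.range f.toLinearMap = O.pure ∧ H = O.g2Image f

/-!
The idea is to describe the spin group of the pure octonions `P` inside the linear group of `C`.
An element `g` of `GSpin(P)` acts on `C` by an operator `T` such that `T (x b) = π(x) T(b)`, where
`π` is the vector representation, first for `x` in `P` (`spinRep_mul`), and then for all octonions
`x` and a suitable extension of `π` fixing the unit (`NormalizesPure.apply_mul`; in characteristic
`2` this uses that the commutant of the even Clifford algebra on `C` is reduced to the scalars,
`exists_eq_smul_of_commute`). Such an operator is a similitude, it is an isometry for `g` in
`Spin(P)`, and an element of `Spin(P)` is in the image of `G₂(C)` if and only if its operator fixes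
the unit (`mem_g2Image`). Since an anisotropic octonion is a product of two anisotropic pure
octonions, `GSpin(P)` moves any anisotropic vector to the unit (`exists_conj_mem_g2Image`). So it
remains to find an anisotropic vector fixed by a group `Γ`, assuming that `C` is semisimple and that
`1` is an eigenvalue of each element.

For a single `γ` acting by `T`, the generalized eigenspace of `T` for the eigenvalue `1` is not
totally singular. If `s` is an anisotropic vector in it, right multiplication by `s` maps the
generalized eigenspaces of `π` into those of `T`, so that `π` and `T` have the same characteristic
polynomial (`charpoly_eq_of_intertwining`). As `π` fixes the unit for the whole of `Γ`, a theorem of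
Brauer-Nesbitt type (`exists_fixed_of_charpoly_eq`) gives a nonzero vector of `C` fixed by `Γ`. By
semisimplicity the fixed vectors form a nondegenerate space (`exists_fixed_q_ne_zero`), so that one
of them is anisotropic. The Brauer-Nesbitt argument is the following: modulo any power of `X`, an
element `1 + X a` with `a` in the group algebra is a product of elements `1 - c X ^ d g` with `g` in
the group, so that the characteristic polynomials on the group determine those on the group
algebra; and a semisimple representation without fixed vector is killed by an element of
augmentation `1`.

For an arbitrary simple module `W` over the even Clifford algebra, the module `C` is simple
(`eq_top_of_stable`) with commutant the scalars, so by the density theorem and a dimension bound the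
even Clifford algebra is the full algebra of endomorphisms of `C`, hence `W` is isomorphic to `C`
(`exists_equiv_spinRep`). Finally, twisting the embedding of the quadratic space in `C` by an element
of the general spin group conjugates the corresponding `G₂`-subgroup (`exists_isometry_conj`).
-/

/-! ### Identities in octonion algebras -/

namespace OctonionAlgebra

variable {k : Type u} [Field k] {C : Type v} [AddCommGroup C] [Module k C]

theorem finiteDimensional (O : OctonionAlgebra k C) : FiniteDimensional k C :=
  Module.finite_of_finrank_pos (by rw [O.finrank_eq]; norm_num)

theorem β_smul_right (O : OctonionAlgebra k C) (r : k) (x z : C) :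
    O.β x (r • z) = r * O.β x z := by simp [β]

theorem β_neg_right (O : OctonionAlgebra k C) (x z : C) : O.β x (-z) = -O.β x z := by simp [β]

theorem β_sub_right (O : OctonionAlgebra k C) (x y z : C) :
    O.β x (y - z) = O.β x y - O.β x z := by simp [β]

theorem β_zero_left (O : OctonionAlgebra k C) (z : C) : O.β 0 z = 0 := by simp [β]

theorem β_zero_right (O : OctonionAlgebra k C) (z : C) : O.β z 0 = 0 := by simp [β]

theorem β_self (O : OctonionAlgebra k C) (x : C) : O.β x x = 2 * O.q x := by
  rw [β_def, ← two_smul k x, QuadraticMap.map_smul, smul_eq_mul]; ring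

theorem e_ne_zero (O : OctonionAlgebra k C) : O.e ≠ 0 := fun h => by
  have := O.q_e
  rw [h, map_zero] at this
  exact zero_ne_one this

theorem mem_pure (O : OctonionAlgebra k C) {x : C} : x ∈ O.pure ↔ O.β x O.e = 0 := by
  rw [β_comm]; rfl

theorem conj_eq_neg (O : OctonionAlgebra k C) {x : C} (hx : x ∈ O.pure) : O.conj x = -x := by
  rw [conj_apply, O.mem_pure.1 hx, zero_smul, zero_sub]

theorem β_conj (O : OctonionAlgebra k C) (x y : C) : O.β (O.conj x) y = O.β x (O.conj y) := by
  rw [conj_apply, conj_apply, β_sub_left, β_smul_left, β_sub_right, β_smul_right, O.β_comm O.e y]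
  ring

theorem β_mul_right (O : OctonionAlgebra k C) (x y z : C) :
    O.β (O.mul y x) (O.mul z x) = O.q x * O.β y z := by
  have h := O.β_cross y z x x
  rw [β_self, O.β_comm (O.mul z x)] at h
  rw [β_def, ← LinearMap.add_apply, ← map_add, O.q_mul, O.q_mul, O.q_mul, q_add]
  ring

theorem β_mul_conj (O : OctonionAlgebra k C) (x y z : C) :
    O.β (O.mul y (O.conj x)) z = O.β y (O.mul z x) := by
  have h := O.β_cross y z O.e x
  rw [O.mul_e, O.mul_e] at h
  rw [conj_apply, map_sub, map_smul, O.mul_e, β_sub_left, β_smul_left]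
  rw [O.β_comm O.e x, O.β_comm z] at h
  linear_combination -h

theorem mul_mul_conj (O : OctonionAlgebra k C) (x y : C) :
    O.mul (O.mul y x) (O.conj x) = O.q x • y :=
  O.ext_β fun z => by rw [β_mul_conj, β_mul_right, β_smul_left]

theorem conj_mul (O : OctonionAlgebra k C) (x y : C) :
    O.conj (O.mul x y) = O.mul (O.conj y) (O.conj x) := by
  refine O.ext_β fun z => ?_
  have h1 := O.β_conj_mul (O.conj x) y (O.conj z)
  rw [conj_conj] at h1
  have h2 := O.β_mul_conj z (O.conj x) y
  have h3 := O.β_conj_mul y (O.conj x) z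
  rw [β_conj, h1, h3, β_comm, h2]

theorem β_mul_left_eq (O : OctonionAlgebra k C) (x y z : C) :
    O.β (O.mul x y) z = O.β y (O.mul (O.conj x) z) := by
  rw [β_comm, β_comm O y, β_conj_mul]

theorem mul_conj_mul_add (O : OctonionAlgebra k C) (x y w : C) :
    O.mul x (O.mul (O.conj y) w) + O.mul y (O.mul (O.conj x) w) = O.β x y • w := by
  have h := O.mul_conj_mul (x + y) w
  simp only [map_add, LinearMap.add_apply, mul_conj_mul, q_add, add_smul] at h
  linear_combination (norm := module) h

theorem mul_conj_add (O : OctonionAlgebra k C) (x y : C) :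
    O.mul x (O.conj y) + O.mul y (O.conj x) = O.β x y • O.e := by
  have h := O.mul_conj_mul_add x y O.e
  rwa [O.mul_e, O.mul_e] at h

theorem pure_mul_mul_self (O : OctonionAlgebra k C) {x : C} (hx : x ∈ O.pure) (w : C) :
    O.mul x (O.mul x w) = -(O.q x • w) := by
  rw [← O.mul_conj_mul x w, O.conj_eq_neg hx]; simp

/-- The Clifford relation for left multiplications by pure octonions. -/
theorem pure_mul_mul_add (O : OctonionAlgebra k C) {x y : C} (hx : x ∈ O.pure) (hy : y ∈ O.pure)
    (w : C) : O.mul x (O.mul y w) + O.mul y (O.mul x w) = -(O.β x y • w) := by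
  rw [← O.mul_conj_mul_add x y w, O.conj_eq_neg hx, O.conj_eq_neg hy]; simp; abel

theorem pure_mul_conj (O : OctonionAlgebra k C) {v a : C} (hv : v ∈ O.pure) (h : O.β a v = 0) :
    O.mul a v = O.mul v (O.conj a) := by
  have := O.mul_conj_add a v
  rw [O.conj_eq_neg hv, h, zero_smul, map_neg] at this
  linear_combination (norm := module) -this

/-- The doubling identity: `a (b v) = (b a) v` for `v` orthogonal to the unit, `a`, `b`, `b a`. -/
theorem mul_mul_of_orthogonal (O : OctonionAlgebra k C) {a b v : C} (hv : v ∈ O.pure)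
    (ha : O.β a v = 0) (hb : O.β b v = 0) (hba : O.β (O.mul b a) v = 0) :
    O.mul a (O.mul b v) = O.mul (O.mul b a) v := by
  rw [O.pure_mul_conj hv hb, O.pure_mul_conj hv hba, O.conj_mul]
  have h := O.mul_conj_mul_add a v (O.conj b)
  rw [ha, O.conj_eq_neg hv] at h
  simp only [map_neg, LinearMap.neg_apply, zero_smul] at h
  linear_combination (norm := module) -h

theorem mul_flip_injective_of_q_ne_zero (O : OctonionAlgebra k C) {x : C} (hx : O.q x ≠ 0) :
    Function.Injective (O.mul.flip x) := fun a b h => by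
  have := congrArg (fun z => O.mul z (O.conj x)) h
  simp only [LinearMap.flip_apply, mul_mul_conj] at this
  exact smul_right_injective C hx this

/-! ### Orthogonal complements and anisotropic vectors -/

/-- The orthogonal of a subspace for the polar form. -/
def orth (O : OctonionAlgebra k C) (S : Submodule k C) : Submodule k C :=
  LinearMap.BilinForm.orthogonal O.q.polarBilin S

theorem mem_orth (O : OctonionAlgebra k C) {S : Submodule k C} {v : C} :
    v ∈ O.orth S ↔ ∀ s ∈ S, O.β s v = 0 := Iff.rfl

theorem isRefl (O : OctonionAlgebra k C) : LinearMap.BilinForm.IsRefl O.q.polarBilin :=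
  fun x y h => by
    change O.β y x = 0
    rw [β_comm]; exact h

theorem finrank_orth (O : OctonionAlgebra k C) (S : Submodule k C) :
    Module.finrank k (O.orth S) = 8 - Module.finrank k S := by
  have := O.finiteDimensional
  rw [← O.finrank_eq]
  exact LinearMap.BilinForm.finrank_orthogonal O.nondegenerate S

theorem finrank_pure (O : OctonionAlgebra k C) : Module.finrank k O.pure = 7 := by
  have h : O.pure = O.orth (k ∙ O.e) := by
    ext x
    simp only [mem_orth, Submodule.mem_span_singleton, forall_exists_index,
      forall_apply_eq_imp_iff, β_smul_left, mem_pure]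
    rw [β_comm]
    exact ⟨fun h r => by rw [h, mul_zero], fun h => by simpa using h 1⟩
  rw [h, finrank_orth, finrank_span_singleton O.e_ne_zero]

theorem β_eq_zero_of_q_eq_zero (O : OctonionAlgebra k C) {N : Submodule k C}
    (hN : ∀ n ∈ N, O.q n = 0) {x y : C} (hx : x ∈ N) (hy : y ∈ N) : O.β x y = 0 := by
  rw [β_def, hN _ (N.add_mem hx hy), hN _ hx, hN _ hy]; ring

theorem finrank_le_four_of_q_eq_zero (O : OctonionAlgebra k C) {N : Submodule k C}
    (hN : ∀ n ∈ N, O.q n = 0) : Module.finrank k N ≤ 4 := by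
  have := O.finiteDimensional
  have h : N ≤ O.orth N := fun x hx => O.mem_orth.2 fun s hs =>
    O.β_eq_zero_of_q_eq_zero hN hs hx
  have h1 := Submodule.finrank_mono h
  rw [finrank_orth] at h1
  omega

/-- A subspace of dimension at most `4` containing the unit has an anisotropic vector in its
orthogonal: otherwise this orthogonal would be totally singular and equal to the subspace. -/
theorem exists_q_ne_zero_mem_orth (O : OctonionAlgebra k C) {S : Submodule k C}
    (hS : Module.finrank k S ≤ 4) (he : O.e ∈ S) : ∃ v ∈ O.orth S, O.q v ≠ 0 := by
  have := O.finiteDimensional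
  by_contra! hN
  have h1 := O.finrank_le_four_of_q_eq_zero hN
  have h2 : O.orth S ≤ S := by
    have h3 : O.orth (O.orth S) = S :=
      LinearMap.BilinForm.orthogonal_orthogonal O.nondegenerate O.isRefl S
    conv_rhs => rw [← h3]
    exact fun x hx => O.mem_orth.2 fun s hs => O.β_eq_zero_of_q_eq_zero hN hs hx
  have h4 := O.finrank_orth S
  have h5 := Submodule.eq_of_le_of_finrank_le h2 (by omega)
  have := hN O.e (by rw [h5]; exact he)
  rw [q_e] at this
  exact one_ne_zero this

theorem exists_q_ne_zero_orthogonal (O : OctonionAlgebra k C) (a b c : C) :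
    ∃ v ∈ O.pure, O.q v ≠ 0 ∧ O.β a v = 0 ∧ O.β b v = 0 ∧ O.β c v = 0 := by
  classical
  obtain ⟨v, hv, hq⟩ := O.exists_q_ne_zero_mem_orth
    (S := Submodule.span k (({O.e, a, b, c} : Finset C) : Set C))
    ((finrank_span_finset_le_card _).trans Finset.card_le_four)
    (Submodule.subset_span (by simp))
  rw [mem_orth] at hv
  refine ⟨v, O.mem_pure.2 ?_, hq, ?_, ?_, ?_⟩
  · rw [β_comm]; exact hv _ (Submodule.subset_span (by simp))
  all_goals exact hv _ (Submodule.subset_span (by simp))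

/-- Every octonion is a product of two pure octonions, the first of which is anisotropic. -/
theorem exists_pure_mul_pure (O : OctonionAlgebra k C) (s : C) :
    ∃ x ∈ O.pure, ∃ y ∈ O.pure, O.q x ≠ 0 ∧ O.mul x y = s := by
  -- `x⁻¹ s` is pure if and only if `x` is orthogonal to `s`
  obtain ⟨x, hx, hq, hxs, -, -⟩ := O.exists_q_ne_zero_orthogonal s s s
  refine ⟨x, hx, (O.q x)⁻¹ • O.mul (O.conj x) s, ?_, hq, ?_⟩
  · rw [mem_pure, β_smul_left, β_conj_mul, O.mul_e, hxs, mul_zero]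
  · rw [map_smul, mul_conj_mul, smul_smul, inv_mul_cancel₀ hq, one_smul]

theorem exists_pure_mul_pure_of_q_ne_zero (O : OctonionAlgebra k C) {s : C} (hs : O.q s ≠ 0) :
    ∃ x ∈ O.pure, ∃ y ∈ O.pure, O.q x ≠ 0 ∧ O.q y ≠ 0 ∧ O.mul x y = s := by
  obtain ⟨x, hx, y, hy, hq, rfl⟩ := O.exists_pure_mul_pure s
  rw [O.q_mul] at hs
  exact ⟨x, hx, y, hy, hq, right_ne_zero_of_mul hs, rfl⟩

/-- Every linear form on the pure octonions is `β z` for some octonion `z`. -/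
theorem exists_β_eq (O : OctonionAlgebra k C) (φ : O.pure →ₗ[k] k) :
    ∃ z : C, ∀ x : O.pure, O.β z x = φ x := by
  have := O.finiteDimensional
  obtain ⟨ψ, hψ⟩ := φ.exists_extend
  refine ⟨(LinearMap.BilinForm.toDual O.q.polarBilin O.nondegenerate).symm ψ, fun x => ?_⟩
  rw [← hψ]
  exact LinearMap.BilinForm.apply_toDual_symm_apply ψ (x : C)

end OctonionAlgebra

/-! ### The commutant of the even Clifford algebra of the pure octonions -/

namespace OctonionAlgebra

variable {k : Type u} [Field k] {C : Type v} [AddCommGroup C] [Module k C]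

theorem exists_eq_smul_e (O : OctonionAlgebra k C) {d : C} (h : ∀ x ∈ O.pure, O.β d x = 0) :
    ∃ c : k, d = c • O.e := by
  have := O.finiteDimensional
  have h3 : O.orth (O.orth (k ∙ O.e)) = k ∙ O.e :=
    LinearMap.BilinForm.orthogonal_orthogonal O.nondegenerate O.isRefl _
  have hd : d ∈ O.orth (O.orth (k ∙ O.e)) := O.mem_orth.2 fun s hs => by
    rw [β_comm]
    refine h s (O.mem_pure.2 ?_)
    rw [β_comm]
    exact O.mem_orth.1 hs _ (Submodule.mem_span_singleton_self _)
  rw [h3, Submodule.mem_span_singleton] at hd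
  exact hd.imp fun c hc => hc.symm

theorem mul_mem_pure (O : OctonionAlgebra k C) {x y : C} (hx : x ∈ O.pure) (h : O.β x y = 0) :
    O.mul x y ∈ O.pure := by
  rw [mem_pure, β_mul_left_eq, O.mul_e, O.conj_eq_neg hx, β_neg_right, β_comm, h, neg_zero]

/-- If right multiplication by `d` is associative up to the sign `ε` on orthogonal pairs of pure
octonions, then `d` commutes up to `ε` with the pure octonions. The proof compares both sides on
an anisotropic vector `v` orthogonal to the unit, `x`, `d` and `d x`. -/
theorem mul_eq_smul_mul_of_twisted (O : OctonionAlgebra k C) {d : C} {ε : k} (hε : ε * ε = 1)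
    (h : ∀ x ∈ O.pure, ∀ y ∈ O.pure, O.β x y = 0 →
      O.mul (O.mul x y) d = ε • O.mul x (O.mul y d))
    {x : C} (hx : x ∈ O.pure) : O.mul x d = ε • O.mul d x := by
  obtain ⟨v, hv, hq, hxv, hdv, hdxv⟩ := O.exists_q_ne_zero_orthogonal x d (O.mul d x)
  have hcv : ∀ {a}, O.β a v = 0 → O.β (O.conj a) v = 0 := fun {a} ha => by
    rw [β_conj, O.conj_eq_neg hv, β_neg_right, ha, neg_zero]
  -- `x (v d) = x (d̄ v) = (d̄ x) v`
  have h1 : O.mul x (O.mul v d) = O.mul (O.mul (O.conj d) x) v := by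
    have h2 := O.pure_mul_conj hv (hcv hdv)
    rw [conj_conj] at h2
    rw [← h2]
    refine O.mul_mul_of_orthogonal hv hxv (hcv hdv) ?_
    rw [conj_apply, map_sub, map_smul, LinearMap.sub_apply, LinearMap.smul_apply, O.e_mul,
      β_sub_left, β_smul_left, hxv, hdxv, mul_zero, sub_zero]
  -- `(x v) d = (x d̄) v`
  have h2 : O.mul (O.mul x v) d = O.mul (O.mul x (O.conj d)) v := by
    have h3 : O.mul (O.conj d) (O.mul (O.conj x) v) =
        O.mul (O.mul (O.conj x) (O.conj d)) v :=
      O.mul_mul_of_orthogonal hv (hcv hdv) (hcv hxv) (by rw [← conj_mul]; exact hcv hdxv)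
    have h4 := O.pure_mul_conj hv (hcv hdxv)
    rw [conj_conj, conj_mul] at h4
    have h5 := congrArg O.conj h3
    rw [conj_mul, conj_mul, conj_conj, conj_conj, O.conj_eq_neg hv, ← conj_mul, conj_mul, conj_conj,
      O.conj_eq_neg hv] at h5
    have h6 := O.pure_mul_conj hv hxv
    rw [O.conj_eq_neg hx] at h4 h6
    rw [h6]
    simp only [map_neg, LinearMap.neg_apply] at h4 h5 ⊢
    rw [neg_inj] at h5
    rw [h5, ← h4]
    simp
  have h3 := h x hx v hv hxv
  rw [h1, h2, ← LinearMap.smul_apply, ← map_smul] at h3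
  have h4 := O.mul_flip_injective_of_q_ne_zero hq (a₁ := O.mul x (O.conj d))
    (a₂ := ε • O.mul (O.conj d) x) h3
  have h5 := congrArg O.conj h4
  rw [map_smul, conj_mul, conj_mul, conj_conj, O.conj_eq_neg hx] at h5
  simp only [map_neg, LinearMap.neg_apply, smul_neg, neg_inj] at h5
  rw [h5, smul_smul, hε, one_smul]

theorem exists_eq_smul_e_of_twisted_comm (O : OctonionAlgebra k C) {d : C} {ε : k}
    (h : ∀ x ∈ O.pure, O.mul x d = ε • O.mul d x) :
    ∃ c : k, d = c • O.e := by
  have key : ∀ x ∈ O.pure, O.β d O.e • x - (1 + ε) • O.mul d x = O.β d x • O.e := by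
    intro x hx
    have h1 := O.mul_conj_add d x
    rw [O.conj_eq_neg hx, O.conj_apply d, map_neg, map_sub, map_smul, O.mul_e, h x hx] at h1
    rw [← h1]
    module
  obtain ⟨x, hx, hq, hdx, -, -⟩ := O.exists_q_ne_zero_orthogonal d d d
  have hx0 : x ≠ 0 := fun h => hq (by rw [h, map_zero])
  by_cases h2 : 1 + ε = 0
  · have h3 := key x hx
    rw [h2, hdx, zero_smul, zero_smul, sub_zero, smul_eq_zero_iff_left hx0] at h3
    refine O.exists_eq_smul_e fun y hy => ?_
    have h4 := key y hy
    rw [h3, h2, zero_smul, zero_smul, sub_zero, eq_comm,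
      smul_eq_zero_iff_left O.e_ne_zero] at h4
    exact h4
  · have h3 := key x hx
    rw [hdx, zero_smul, sub_eq_zero] at h3
    have h4 : O.mul.flip x (O.β d O.e • O.e) = O.mul.flip x ((1 + ε) • d) := by
      rw [map_smul, map_smul, LinearMap.flip_apply, LinearMap.flip_apply, O.e_mul, h3]
    have h5 := O.mul_flip_injective_of_q_ne_zero hq h4
    refine ⟨(1 + ε)⁻¹ * O.β d O.e, ?_⟩
    rw [mul_smul, h5, smul_smul, inv_mul_cancel₀ h2, one_smul]

/-- An operator that commutes up to a sign with left multiplications by pure octonions is a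
scalar, which vanishes if the sign is not `1`. -/
theorem exists_eq_smul_of_twisted_commute (O : OctonionAlgebra k C) {D : Module.End k C} {ε : k}
    (hε : ε * ε = 1) (hD : ∀ x ∈ O.pure, ∀ w, D (O.mul x w) = ε • O.mul x (D w)) :
    ∃ c : k, (∀ w, D w = c • w) ∧ (1 - ε) * c = 0 := by
  have hD2 : ∀ x ∈ O.pure, ∀ y ∈ O.pure, D (O.mul x y) = O.mul x (O.mul y (D O.e)) := by
    intro x hx y hy
    have := hD y hy O.e
    rw [O.mul_e] at this
    rw [hD x hx, this, map_smul, smul_smul, hε, one_smul]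
  have tw : ∀ x ∈ O.pure, ∀ y ∈ O.pure, O.β x y = 0 →
      O.mul (O.mul x y) (D O.e) = ε • O.mul x (O.mul y (D O.e)) := by
    intro x hx y hy hxy
    have h := hD _ (O.mul_mem_pure hx hxy) O.e
    rw [O.mul_e, hD2 x hx y hy] at h
    rw [h, smul_smul, hε, one_smul]
  have tc : ∀ x ∈ O.pure, O.mul x (D O.e) = ε • O.mul (D O.e) x :=
    fun x hx => O.mul_eq_smul_mul_of_twisted hε tw hx
  obtain ⟨c, hc⟩ := O.exists_eq_smul_e_of_twisted_comm tc
  refine ⟨c, fun w => ?_, ?_⟩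
  · obtain ⟨x, hx, y, hy, -, rfl⟩ := O.exists_pure_mul_pure w
    rw [hD2 x hx y hy, hc, map_smul, map_smul, O.mul_e]
  · obtain ⟨x, hx, hq, -⟩ := O.exists_q_ne_zero_orthogonal 0 0 0
    have hx0 : x ≠ 0 := fun h => hq (by rw [h, map_zero])
    have h := tc x hx
    rw [hc, map_smul, map_smul, LinearMap.smul_apply, O.mul_e, O.e_mul, smul_smul, ← sub_eq_zero,
      ← sub_smul, smul_eq_zero_iff_left hx0] at h
    linear_combination h

theorem e_mem_pure (O : OctonionAlgebra k C) (h2 : (2 : k) = 0) : O.e ∈ O.pure := by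
  rw [mem_pure, β_e_e, h2]

/-- Schur's lemma: an operator on `C` that commutes with the products of two left multiplications
by pure octonions is a scalar. -/
theorem exists_eq_smul_of_commute (O : OctonionAlgebra k C) {D : Module.End k C}
    (hD : ∀ x ∈ O.pure, ∀ y ∈ O.pure, ∀ w,
      D (O.mul x (O.mul y w)) = O.mul x (O.mul y (D w))) :
    ∃ c : k, ∀ w, D w = c • w := by
  by_cases h2 : (2 : k) = 0
  · obtain ⟨c, hc, -⟩ := O.exists_eq_smul_of_twisted_commute (ε := 1) (D := D) (by ring)
      fun x hx w => by
        have := hD _ (O.e_mem_pure h2) x hx w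
        rwa [O.e_mul, O.e_mul, ← one_smul k (O.mul x (D w))] at this
    exact ⟨c, hc⟩
  · obtain ⟨x₀, hx₀, hq, -⟩ := O.exists_q_ne_zero_orthogonal 0 0 0
    -- the conjugate of `D` by left multiplication by `x₀`
    let D' : Module.End k C := (-(O.q x₀)⁻¹) • (O.mul x₀ ∘ₗ D ∘ₗ O.mul x₀)
    have hD'_apply : ∀ w, D' w = (-(O.q x₀)⁻¹) • O.mul x₀ (D (O.mul x₀ w)) := fun _ => rfl
    have h1 : ∀ x ∈ O.pure, ∀ w, D' (O.mul x w) = O.mul x (D w) := by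
      intro x hx w
      rw [hD'_apply, hD x₀ hx₀ x hx, O.pure_mul_mul_self hx₀, smul_neg, neg_smul, neg_neg,
        smul_smul, inv_mul_cancel₀ hq, one_smul]
    have h3 : ∀ x ∈ O.pure, ∀ w, D (O.mul x w) = O.mul x (D' w) := by
      intro x hx w
      rw [hD'_apply, map_smul, ← hD x hx x₀ hx₀, O.pure_mul_mul_self hx₀, map_neg, map_neg,
        map_smul, map_smul, smul_neg, neg_smul, neg_neg, smul_smul, inv_mul_cancel₀ hq, one_smul]
    obtain ⟨c, hc, -⟩ := O.exists_eq_smul_of_twisted_commute (ε := 1) (D := D + D') (by ring)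
      fun x hx w => by
        rw [LinearMap.add_apply, h1 x hx, h3 x hx, LinearMap.add_apply, map_add, one_smul,
          add_comm]
    obtain ⟨c', hc', h0⟩ := O.exists_eq_smul_of_twisted_commute (ε := -1) (D := D - D') (by ring)
      fun x hx w => by
        rw [LinearMap.sub_apply, h1 x hx, h3 x hx, LinearMap.sub_apply, map_sub, neg_smul,
          one_smul, neg_sub]
    have h0' : c' = 0 := by
      rw [show (1 : k) - -1 = 2 by ring] at h0
      exact (mul_eq_zero.1 h0).resolve_left h2
    refine ⟨2⁻¹ * c, fun w => ?_⟩
    have e1 := hc w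
    have e2 := hc' w
    rw [h0', zero_smul] at e2
    rw [mul_smul, ← e1, eq_inv_smul_iff₀ h2, two_smul, LinearMap.add_apply]
    rw [LinearMap.sub_apply, sub_eq_zero] at e2
    rw [← e2]

/-! ### Simplicity of the spinor module -/

theorem q_eq_zero_of_mul_eq_zero (O : OctonionAlgebra k C) {x n : C} (hn : n ≠ 0)
    (h : O.mul x n = 0) : O.q x = 0 := by
  have h1 := O.conj_mul_mul x n
  rw [h, map_zero, eq_comm, smul_eq_zero_iff_left hn] at h1
  exact h1

/-- The pure octonions annihilating a nonzero vector form a space of dimension at most `3`: they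
are totally singular, and a totally singular space of dimension `4` is its own orthogonal, hence is
not orthogonal to the unit. -/
theorem finrank_annihilator_le (O : OctonionAlgebra k C) {n : C} (hn : n ≠ 0) :
    Module.finrank k (LinearMap.ker ((O.mul.flip n).domRestrict O.pure)) ≤ 3 := by
  have := O.finiteDimensional
  set K := LinearMap.ker ((O.mul.flip n).domRestrict O.pure) with hK
  set S := K.map O.pure.subtype with hS
  have hfr : Module.finrank k S = Module.finrank k K := Submodule.finrank_map_subtype_eq _ _
  by_contra! hlt
  have hSS : O.orth (O.orth S) = S :=
    LinearMap.BilinForm.orthogonal_orthogonal O.nondegenerate O.isRefl _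
  obtain ⟨v, hv, hq⟩ := O.exists_q_ne_zero_mem_orth (S := O.orth S)
    (by rw [finrank_orth]; omega)
    (O.mem_orth.2 fun s hs => by
      obtain ⟨x, -, rfl⟩ := hs
      exact O.mem_pure.1 x.2)
  rw [hSS] at hv
  obtain ⟨x, hx, rfl⟩ := hv
  exact hq (O.q_eq_zero_of_mul_eq_zero hn hx)

/-- Linear forms on a totally singular space `K` of pure octonions are represented by pure
octonions: `K` meets the radical of the pure octonions trivially. -/
theorem exists_pure_β_eq (O : OctonionAlgebra k C) (K : Submodule k O.pure)
    (hK : ∀ x ∈ K, O.q x = 0) (φ : K →ₗ[k] k) :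
    ∃ y ∈ O.pure, ∀ x : K, O.β (x : O.pure) y = φ x := by
  have := O.finiteDimensional
  let B : K →ₗ[k] Module.Dual k O.pure :=
    (O.q.polarBilin.compl₁₂ O.pure.subtype O.pure.subtype) ∘ₗ K.subtype
  have hB : Function.Injective B := by
    rw [injective_iff_map_eq_zero]
    intro x hx
    obtain ⟨c, hc⟩ := O.exists_eq_smul_e (d := (x : O.pure)) fun y hy =>
      LinearMap.congr_fun hx ⟨y, hy⟩
    have h0 := hK x x.2
    rw [hc, QuadraticMap.map_smul, q_e, smul_eq_mul, mul_one, mul_self_eq_zero] at h0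
    rw [h0, zero_smul] at hc
    exact Subtype.ext (Subtype.ext hc)
  obtain ⟨ψ, hψ⟩ := LinearMap.dualMap_surjective_of_injective hB φ
  obtain ⟨y, rfl⟩ := (Module.evalEquiv k O.pure).surjective ψ
  refine ⟨y, y.2, fun x => ?_⟩
  rw [← hψ]
  rfl

/-- A subspace stable under products of two left multiplications by pure octonions, and containing
an anisotropic vector, is the whole space. -/
theorem eq_top_of_stable_of_q_ne_zero (O : OctonionAlgebra k C) {N : Submodule k C}
    (hN : ∀ x ∈ O.pure, ∀ y ∈ O.pure, ∀ n ∈ N, O.mul x (O.mul y n) ∈ N) {s : C} (hs : s ∈ N)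
    (hq : O.q s ≠ 0) : N = ⊤ := by
  obtain ⟨x, hx, y, hy, hqx, hqy, rfl⟩ := O.exists_pure_mul_pure_of_q_ne_zero hq
  have he : O.e ∈ N := by
    have h := hN y hy x hx _ hs
    have h2 := O.pure_mul_mul_self hy O.e
    rw [O.mul_e] at h2
    rw [O.pure_mul_mul_self hx, map_neg, map_smul, h2, smul_neg, neg_neg, smul_smul] at h
    exact (N.smul_mem_iff (mul_ne_zero hqx hqy)).1 h
  refine eq_top_iff.2 fun w _ => ?_
  obtain ⟨x, hx, y, hy, -, rfl⟩ := O.exists_pure_mul_pure w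
  have h := hN x hx y hy _ he
  rwa [O.mul_e] at h

/-- `C` is a simple module under products of two left multiplications by pure octonions.
If a proper stable subspace contains `n ≠ 0`, it is totally singular, and `P n` is the whole
image `N'` of the stable subspace by a left multiplication, for dimension reasons. If `x₀, x₁, x₂`
is a basis of the annihilator of `n` in `P` and `y₀, y₁, y₂` is a dual family, then
`y₀ (y₁ (y₂ n))` is of the form `z n`, and applying `x₀, x₁, x₂` gives `n = 0`. -/
theorem eq_top_of_stable (O : OctonionAlgebra k C) {N : Submodule k C}
    (hN : ∀ x ∈ O.pure, ∀ y ∈ O.pure, ∀ n ∈ N, O.mul x (O.mul y n) ∈ N) (h0 : N ≠ ⊥) :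
    N = ⊤ := by
  have := O.finiteDimensional
  by_cases hsing : ∀ n ∈ N, O.q n = 0
  swap
  · push Not at hsing
    obtain ⟨s, hs, hq⟩ := hsing
    exact O.eq_top_of_stable_of_q_ne_zero hN hs hq
  exfalso
  obtain ⟨n, hn, hn0⟩ := N.ne_bot_iff.1 h0
  obtain ⟨x₀, hx₀, hq₀, -⟩ := O.exists_q_ne_zero_orthogonal 0 0 0
  have hN' : ∀ x ∈ O.pure, ∀ m ∈ N, O.mul x m ∈ N.map (O.mul x₀) := by
    intro x hx m hm
    refine ⟨-((O.q x₀)⁻¹ • O.mul x₀ (O.mul x m)),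
      N.neg_mem (N.smul_mem _ (hN x₀ hx₀ x hx m hm)), ?_⟩
    rw [map_neg, map_smul, O.pure_mul_mul_self hx₀, smul_neg, neg_neg, smul_smul,
      inv_mul_cancel₀ hq₀, one_smul]
  have hN'4 : Module.finrank k (N.map (O.mul x₀)) ≤ 4 := by
    refine O.finrank_le_four_of_q_eq_zero ?_
    rintro _ ⟨m, hm, rfl⟩
    rw [O.q_mul, hsing m hm, mul_zero]
  set R := (O.mul.flip n).domRestrict O.pure with hR
  have hR_apply : ∀ x : O.pure, R x = O.mul x n := fun _ => rfl
  have hrange : LinearMap.range R ≤ N.map (O.mul x₀) := by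
    rintro _ ⟨x, rfl⟩
    exact hN' x x.2 n hn
  have hrank := LinearMap.finrank_range_add_finrank_ker R
  rw [O.finrank_pure] at hrank
  have hker := O.finrank_annihilator_le hn0
  rw [← hR] at hker
  have hle := Submodule.finrank_mono hrange
  have heq : LinearMap.range R = N.map (O.mul x₀) :=
    Submodule.eq_of_le_of_finrank_le hrange (by omega)
  have hker3 : Module.finrank k (LinearMap.ker R) = 3 := by omega
  let b := Module.finBasisOfFinrankEq k (LinearMap.ker R) hker3
  have hdual := fun i => O.exists_pure_β_eq (LinearMap.ker R)
    (fun x hx => O.q_eq_zero_of_mul_eq_zero hn0 hx) (b.coord i)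
  choose y hyP hy using hdual
  have hβ : ∀ i j, O.β (b i : O.pure) (y j) = if i = j then 1 else 0 := fun i j => by
    rw [hy, b.coord_apply, b.repr_self, Finsupp.single_apply]
  have hbn : ∀ i, O.mul (b i : O.pure) n = 0 := fun i => (b i).2
  have hbP : ∀ i, ((b i : O.pure) : C) ∈ O.pure := fun i => (b i : O.pure).2
  have hcl : ∀ i j w, O.mul (b i : O.pure) (O.mul (y j) w) =
      -((if i = j then (1 : k) else 0) • w) - O.mul (y j) (O.mul (b i : O.pure) w) := by
    intro i j w
    rw [← hβ, ← O.pure_mul_mul_add (hbP i) (hyP j)]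
    abel
  have hmem : O.mul (y 0) (O.mul (y 1) (O.mul (y 2) n)) ∈ LinearMap.range R := by
    rw [heq]
    exact hN' _ (hyP 0) _ (hN _ (hyP 1) _ (hyP 2) n hn)
  obtain ⟨z, hz⟩ := hmem
  rw [hR_apply] at hz
  have hzn : ∀ i, O.mul (b i : O.pure) (O.mul z n) = -(O.β (b i : O.pure) z • n) := fun i => by
    rw [← O.pure_mul_mul_add (hbP i) z.2, hbn, map_zero, add_zero]
  have h1 := congrArg (O.mul (b 0 : O.pure)) hz
  rw [hzn, hcl, hcl, hcl, hbn] at h1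
  simp only [if_true, Fin.reduceEq, if_false, zero_smul, one_smul, neg_zero, map_zero,
    sub_zero] at h1
  have h2 := congrArg (O.mul (b 1 : O.pure)) h1
  rw [map_neg, map_neg, map_smul, hbn, hcl, hcl, hbn] at h2
  simp only [if_true, Fin.reduceEq, if_false, zero_smul, one_smul, neg_zero, map_zero,
    sub_zero, smul_zero, neg_neg] at h2
  have h3 := congrArg (O.mul (b 2 : O.pure)) h2
  rw [hcl, hbn] at h3
  simp only [if_true, one_smul, map_zero, sub_zero] at h3
  exact hn0 (neg_eq_zero.1 h3.symm)

end OctonionAlgebra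

/-! ### Characteristic polynomials and invariants of semisimple representations -/

section GroupAlgebra

open Polynomial

variable {k : Type*} [Field k] {S : Type*} [Ring S] [Algebra k[X] S] {G : Type*} [Monoid G]

theorem mul_mem_span_range {R : Type*} [CommRing R] [Algebra R S] (γ : G →* S) {a b : S}
    (ha : a ∈ Submodule.span R (Set.range γ)) (hb : b ∈ Submodule.span R (Set.range γ)) :
    a * b ∈ Submodule.span R (Set.range γ) := by
  have h1 := Submodule.mul_mem_mul ha hb
  rw [Submodule.span_mul_span] at h1
  refine Submodule.span_mono ?_ h1
  rintro _ ⟨_, ⟨x, rfl⟩, _, ⟨y, rfl⟩, rfl⟩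
  exact ⟨x * y, map_mul γ x y⟩

/-- Modulo `X ^ (d + 2)`, every `1 - X ^ (d + 1) q` with `q` in the span of a monoid is a product of
elements `1 - c X ^ (d + 1) g` with `g` in the monoid, so that two multiplicative functions that
agree on the latter agree on some element congruent to the former. -/
theorem exists_one_sub_add_eq (γ : G →* S) (D D' : S →* k[X])
    (h : ∀ (g : G) (c : k) (d : ℕ), D (1 - (C c * X ^ d : k[X]) • γ g) =
      D' (1 - (C c * X ^ d : k[X]) • γ g)) (d : ℕ) {q : S}
    (hq : q ∈ Submodule.span k[X] (Set.range γ)) :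
    ∃ q' ∈ Submodule.span k[X] (Set.range γ),
      D (1 - (X ^ (d + 1) : k[X]) • q + (X ^ (d + 2) : k[X]) • q') =
        D' (1 - (X ^ (d + 1) : k[X]) • q + (X ^ (d + 2) : k[X]) • q') := by
  induction hq using Submodule.closure_induction with
  | zero => exact ⟨0, Submodule.zero_mem _, by simp⟩
  | add a b ha hb iha ihb =>
    obtain ⟨a', ha', ha''⟩ := iha
    obtain ⟨b', hb', hb''⟩ := ihb
    refine ⟨a' + b' + (X ^ d : k[X]) • (a * b) - (X ^ (d + 1) : k[X]) • (a * b') -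
      (X ^ (d + 1) : k[X]) • (a' * b) + (X ^ (d + 2) : k[X]) • (a' * b'), ?_, ?_⟩
    · refine Submodule.add_mem _ (Submodule.sub_mem _ (Submodule.sub_mem _ (Submodule.add_mem _
        (Submodule.add_mem _ ha' hb') ?_) ?_) ?_) ?_
      all_goals exact Submodule.smul_mem _ _ (mul_mem_span_range γ (by assumption) (by assumption))
    · have : 1 - (X ^ (d + 1) : k[X]) • (a + b) + (X ^ (d + 2) : k[X]) •
          (a' + b' + (X ^ d : k[X]) • (a * b) - (X ^ (d + 1) : k[X]) • (a * b') -
          (X ^ (d + 1) : k[X]) • (a' * b) + (X ^ (d + 2) : k[X]) • (a' * b')) =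
          (1 - (X ^ (d + 1) : k[X]) • a + (X ^ (d + 2) : k[X]) • a') *
          (1 - (X ^ (d + 1) : k[X]) • b + (X ^ (d + 2) : k[X]) • b') := by
        simp only [add_mul, mul_add, sub_mul, mul_sub, one_mul, mul_one, smul_mul_assoc,
          mul_smul_comm]
        module
      rw [this, map_mul, map_mul, ha'', hb'']
  | smul_mem p x hx =>
    obtain ⟨g, rfl⟩ := hx
    refine ⟨p.divX • γ g, Submodule.smul_mem _ _ (Submodule.subset_span ⟨g, rfl⟩), ?_⟩
    have : 1 - (X ^ (d + 1) : k[X]) • p • γ g + (X ^ (d + 2) : k[X]) • (p.divX • γ g) =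
        1 - (C (p.coeff 0) * X ^ (d + 1) : k[X]) • γ g := by
      have hp := p.divX_mul_X_add
      generalize p.divX = p', p.coeff 0 = c at hp
      rw [← hp]
      module
    rw [this, h]

/-- Two multiplicative functions that agree on the elements `1 - c X ^ d g` with `g` in a monoid
agree, `X`-adically, on all the elements `1 + X q` with `q` in the span of the monoid. The proof is by
descending induction on the order of vanishing of the second term, each step cancelling its leading
term. -/
theorem X_pow_dvd_sub (γ : G →* S) (D D' : S →* k[X]) (N : ℕ)
    (hD : ∀ n s, (X ^ n : k[X]) ∣ D (1 + (X ^ n : k[X]) • s) - 1)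
    (hD' : ∀ n s, (X ^ n : k[X]) ∣ D' (1 + (X ^ n : k[X]) • s) - 1)
    (h : ∀ (g : G) (c : k) (d : ℕ), D (1 - (C c * X ^ d : k[X]) • γ g) =
      D' (1 - (C c * X ^ d : k[X]) • γ g)) (j : ℕ) :
    ∀ d, d + j = N → ∀ q ∈ Submodule.span k[X] (Set.range γ),
      (X ^ (N + 1) : k[X]) ∣ D (1 + (X ^ (d + 1) : k[X]) • q) -
        D' (1 + (X ^ (d + 1) : k[X]) • q) := by
  induction j with
  | zero =>
    rintro d rfl q -
    have := dvd_sub (hD (d + 1) q) (hD' (d + 1) q)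
    rwa [sub_sub_sub_cancel_right] at this
  | succ j ih =>
    intro d hd q hq
    obtain ⟨q', hq', he⟩ := exists_one_sub_add_eq γ D D' h d hq
    set r := 1 - (X ^ (d + 1) : k[X]) • q + (X ^ (d + 2) : k[X]) • q' with hr
    have hprod : (1 + (X ^ (d + 1) : k[X]) • q) * r = 1 + (X ^ (d + 1 + 1) : k[X]) •
        (q' - (X ^ d : k[X]) • (q * q) + (X ^ (d + 1) : k[X]) • (q * q')) := by
      rw [hr]
      simp only [add_mul, mul_add, mul_sub, one_mul, mul_one, smul_mul_assoc, mul_smul_comm]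
      module
    have h1 := ih (d + 1) (by omega)
      (q' - (X ^ d : k[X]) • (q * q) + (X ^ (d + 1) : k[X]) • (q * q'))
      (Submodule.add_mem _ (Submodule.sub_mem _ hq' (Submodule.smul_mem _ _ (mul_mem_span_range γ hq hq)))
        (Submodule.smul_mem _ _ (mul_mem_span_range γ hq hq')))
    rw [← hprod, map_mul, map_mul, ← he, ← sub_mul] at h1
    have hr1 : r = 1 + (X ^ 1 : k[X]) • ((X ^ (d + 1) : k[X]) • q' - (X ^ d : k[X]) • q) := by
      rw [hr]; module
    have hcop : IsCoprime (X ^ (N + 1) : k[X]) (D r) := by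
      refine IsCoprime.pow_left ?_
      obtain ⟨v, hv⟩ := hD 1 ((X ^ (d + 1) : k[X]) • q' - (X ^ d : k[X]) • q)
      rw [← hr1, pow_one] at hv
      exact ⟨-v, 1, by linear_combination hv⟩
    exact hcop.dvd_of_dvd_mul_right h1

theorem X_pow_dvd_det_sub_one {n : Type*} [Fintype n] [DecidableEq n] (d : ℕ)
    (M : Matrix n n k[X]) : (X ^ d : k[X]) ∣ (1 + (X ^ d : k[X]) • M).det - 1 := by
  rw [← Ideal.mem_span_singleton, ← Ideal.Quotient.mk_eq_mk_iff_sub_mem, RingHom.map_det, map_one]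
  rw [← Matrix.det_one (n := n)]
  congr 1
  ext i j
  have : Ideal.Quotient.mk (Ideal.span {(X ^ d : k[X])}) (X ^ d) = 0 :=
    Ideal.Quotient.eq_zero_iff_mem.2 (Ideal.mem_span_singleton_self _)
  rcases eq_or_ne i j with rfl | hij
  · simp [-map_pow, this]
  · simp [-map_pow, this, hij]

theorem det_one_sub_smul_map {n : Type*} [Fintype n] [DecidableEq n] (A : Matrix n n k) (c : k)
    (d : ℕ) : (1 - (C c * X ^ d : k[X]) • A.map C).det =
      A.charpolyRev.comp (C c * X ^ d : k[X]) := by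
  rw [Matrix.charpolyRev, ← coe_compRingHom_apply, RingHom.map_det]
  congr 1
  refine Matrix.ext fun i j => ?_
  rcases eq_or_ne i j with rfl | hij
  · simp; ring
  · simp [hij]; ring

/-- If two finite-dimensional representations of a monoid have the same characteristic
polynomials on the monoid, an element of the monoid algebra acting by `0` in the first one has no
nonzero fixed vector in the second one. -/
theorem eq_zero_of_charpoly_eq {V U : Type*} [AddCommGroup V] [Module k V] [FiniteDimensional k V]
    [AddCommGroup U] [Module k U] [FiniteDimensional k U]
    (ρ : Representation k G V) (π : Representation k G U)
    (h : ∀ g, (ρ g).charpoly = (π g).charpoly) {a : MonoidAlgebra k G}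
    (ha : ρ.asAlgebraHom a = 0) {x : U} (hx : π.asAlgebraHom a x = x) : x = 0 := by
  by_contra hx0
  let b := Module.finBasis k V
  let b' := Module.finBasis k U
  -- the two representations in matrix form, with coefficients extended to `k[X]`
  let F : Module.End k V →ₐ[k] Matrix _ _ k[X] :=
    (Algebra.ofId k k[X]).mapMatrix.comp (LinearMap.toMatrixAlgEquiv b).toAlgHom
  let F' : Module.End k U →ₐ[k] Matrix _ _ k[X] :=
    (Algebra.ofId k k[X]).mapMatrix.comp (LinearMap.toMatrixAlgEquiv b').toAlgHom
  let Φ := (F.comp ρ.asAlgebraHom).prod (F'.comp π.asAlgebraHom)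
  let γ := (MonoidHomClass.toMonoidHom Φ).comp (MonoidAlgebra.of k G)
  let D := (Matrix.detMonoidHom (n := Fin (Module.finrank k V)) (R := k[X])).comp
    (MonoidHom.fst _ (Matrix (Fin (Module.finrank k U)) (Fin (Module.finrank k U)) k[X]))
  let D' := (Matrix.detMonoidHom (n := Fin (Module.finrank k U)) (R := k[X])).comp
    (MonoidHom.snd (Matrix (Fin (Module.finrank k V)) (Fin (Module.finrank k V)) k[X]) _)
  have hγ1 : ∀ g, (γ g).1 = (LinearMap.toMatrixAlgEquiv b (ρ g)).map C := fun g => by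
    simp [γ, Φ, F]; rfl
  have hγ2 : ∀ g, (γ g).2 = (LinearMap.toMatrixAlgEquiv b' (π g)).map C := fun g => by
    simp [γ, Φ, F']; rfl
  have hspan : ∀ a, Φ a ∈ Submodule.span k[X] (Set.range γ) := by
    intro a
    induction a using MonoidAlgebra.induction_linear with
    | zero => rw [map_zero]; exact Submodule.zero_mem _
    | add x y hx hy => rw [map_add]; exact Submodule.add_mem _ hx hy
    | single g c =>
      have : Φ (MonoidAlgebra.single g c) = (C c : k[X]) • γ g := by
        have h1 : MonoidAlgebra.single g c = c • MonoidAlgebra.of k G g := by simp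
        rw [h1, map_smul, ← Polynomial.algebraMap_eq, algebraMap_smul]
        rfl
      rw [this]
      exact Submodule.smul_mem _ _ (Submodule.subset_span ⟨g, rfl⟩)
  have hagree : ∀ (g : G) (c : k) (d : ℕ), D (1 - (C c * X ^ d : k[X]) • γ g) =
      D' (1 - (C c * X ^ d : k[X]) • γ g) := by
    intro g c d
    change (1 - (C c * X ^ d : k[X]) • (γ g).1).det = (1 - (C c * X ^ d : k[X]) • (γ g).2).det
    have h1 := LinearMap.charpoly_toMatrix (ρ g) b
    have h2 := LinearMap.charpoly_toMatrix (π g) b'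
    rw [hγ1, hγ2, det_one_sub_smul_map, det_one_sub_smul_map, ← Matrix.reverse_charpoly,
      ← Matrix.reverse_charpoly]
    change (LinearMap.toMatrix b b (ρ g)).charpoly.reverse.comp _ =
      (LinearMap.toMatrix b' b' (π g)).charpoly.reverse.comp _
    rw [h1, h2, h]
  set A := LinearMap.toMatrixAlgEquiv b' (π.asAlgebraHom a) with hA
  have hdvd : ∀ N, (X ^ (N + 1) : k[X]) ∣ 1 - A.charpolyRev := by
    intro N
    have := X_pow_dvd_sub γ D D' N (fun n s => X_pow_dvd_det_sub_one n s.1)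
      (fun n s => X_pow_dvd_det_sub_one n s.2) hagree N 0 (zero_add N) _
      (Submodule.neg_mem _ (hspan a))
    have e1 : D (1 + (X ^ (0 + 1) : k[X]) • -Φ a) = 1 := by
      change (1 + (X ^ (0 + 1) : k[X]) • -(F (ρ.asAlgebraHom a))).det = 1
      rw [ha, map_zero, neg_zero, smul_zero, add_zero, Matrix.det_one]
    have e2 : D' (1 + (X ^ (0 + 1) : k[X]) • -Φ a) = A.charpolyRev := by
      change (1 + (X ^ (0 + 1) : k[X]) • -(A.map C)).det = A.charpolyRev
      rw [zero_add, pow_one, smul_neg, ← sub_eq_add_neg, Matrix.charpolyRev]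
    rwa [e1, e2] at this
  have hone : 1 - A.charpolyRev = 0 := by
    by_contra hne
    have h1 := Polynomial.natDegree_le_of_dvd (hdvd (1 - A.charpolyRev).natDegree) hne
    rw [natDegree_X_pow] at h1
    omega
  -- at `X = 1`, the reverse characteristic polynomial is `det (1 - A)`, which vanishes
  have heval : A.charpolyRev.eval 1 = 0 := by
    rw [Matrix.charpolyRev, ← coe_evalRingHom, RingHom.map_det]
    have h1 : (evalRingHom (1 : k)).mapMatrix (1 - (X : k[X]) • A.map C) = 1 - A := by
      refine Matrix.ext fun i j => ?_
      rcases eq_or_ne i j with rfl | hij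
      · simp
      · simp [hij]
    rw [h1, ← Matrix.exists_mulVec_eq_zero_iff]
    refine ⟨b'.repr x, fun h0 => hx0 ?_, ?_⟩
    · exact b'.repr.map_eq_zero_iff.1 (DFunLike.coe_injective h0)
    · rw [Matrix.sub_mulVec, Matrix.one_mulVec, hA]
      have := LinearMap.toMatrix_mulVec_repr b' b' (π.asAlgebraHom a) x
      change _ - (LinearMap.toMatrix b' b' _).mulVec _ = 0
      rw [this, hx, sub_self]
  rw [← sub_eq_zero.1 hone, eval_one] at heval
  exact one_ne_zero heval

/-- A semisimple representation without nonzero fixed vector is annihilated by an element of the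
monoid algebra of augmentation `1`. -/
theorem exists_asAlgebraHom_eq_zero {V : Type*} [AddCommGroup V] [Module k V]
    [FiniteDimensional k V] (ρ : Representation k G V) (hss : ρ.IsSemisimpleRepresentation)
    (h : ∀ v, (∀ g, ρ g v = v) → v = 0) :
    ∃ a : MonoidAlgebra k G, ρ.asAlgebraHom a = 0 ∧ MonoidAlgebra.lift k k G 1 a = 1 := by
  set ε : MonoidAlgebra k G →ₐ[k] k := MonoidAlgebra.lift k k G 1 with hε
  have hε1 : ∀ g, ε (MonoidAlgebra.of k G g) = 1 := fun g => by
    rw [hε, MonoidAlgebra.lift_of]; rfl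
  by_contra! hne
  have hker : ∀ a, ρ.asAlgebraHom a = 0 → ε a = 0 := by
    intro a ha
    by_contra h0
    refine hne ((ε a)⁻¹ • a) (by rw [map_smul, ha, smul_zero]) ?_
    rw [map_smul, smul_eq_mul, inv_mul_cancel₀ h0]
  have := (Representation.isSemisimpleRepresentation_iff_isSemisimpleModule_asModule ρ).1 hss
  let b := Module.finBasis k V
  let F : MonoidAlgebra k G →ₗ[MonoidAlgebra k G] (Fin (Module.finrank k V) → ρ.asModule) :=
    LinearMap.toSpanSingleton _ _ (fun i => ρ.asModuleEquiv.symm (b i))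
  have hF : ∀ a i, ρ.asModuleEquiv (F a i) = ρ.asAlgebraHom a (b i) := fun a i => rfl
  obtain ⟨T, hT⟩ := exists_isCompl (Submodule.map F (RingHom.ker ε))
  have h1 : F 1 ∈ Submodule.map F (RingHom.ker ε) ⊔ T := by rw [hT.sup_eq_top]; trivial
  obtain ⟨_, ⟨j, hj, rfl⟩, t, ht, hjt⟩ := Submodule.mem_sup.1 h1
  have ht1 : t = F (1 - j) := by rw [map_sub, ← hjt, add_sub_cancel_left]
  have hfix : ∀ g, MonoidAlgebra.of k G g • t = t := by
    intro g
    rw [← sub_eq_zero]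
    refine Submodule.disjoint_def.1 hT.disjoint _ ⟨(MonoidAlgebra.of k G g - 1) * (1 - j), ?_, ?_⟩
      (T.sub_mem (T.smul_mem _ ht) ht)
    · change ε _ = 0
      rw [map_mul, map_sub, hε1, map_one, sub_self, zero_mul]
    · rw [← smul_eq_mul, map_smul, ← ht1, sub_smul, one_smul]
  have ht0 : t = 0 := by
    funext i
    refine ρ.asModuleEquiv.injective ((h _ fun g => ?_).trans (map_zero _).symm)
    have := congrArg ρ.asModuleEquiv (congrFun (hfix g) i)
    rw [Pi.smul_apply, Representation.asModuleEquiv_map_smul, Representation.asAlgebraHom_of] at this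
    exact this
  have h2 : ρ.asAlgebraHom (1 - j) = 0 := b.ext fun i => by
    rw [← hF, ← ht1, ht0]
    simp
  have h3 := hker _ h2
  rw [map_sub, map_one, show ε j = 0 from hj, sub_zero] at h3
  exact one_ne_zero h3

/-- A semisimple representation that has the same characteristic polynomials as a representation
with a nonzero fixed vector has a nonzero fixed vector. -/
theorem exists_fixed_of_charpoly_eq {V U : Type*} [AddCommGroup V] [Module k V]
    [FiniteDimensional k V] [AddCommGroup U] [Module k U] [FiniteDimensional k U]
    (ρ : Representation k G V) (hss : ρ.IsSemisimpleRepresentation) (π : Representation k G U)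
    (h : ∀ g, (ρ g).charpoly = (π g).charpoly) {x : U} (hx : x ≠ 0) (hfix : ∀ g, π g x = x) :
    ∃ v ≠ 0, ∀ g, ρ g v = v := by
  by_contra! hne
  obtain ⟨a, ha, ha1⟩ := exists_asAlgebraHom_eq_zero ρ hss fun v hv => by
    by_contra h0
    obtain ⟨g, hg⟩ := hne v h0
    exact hg (hv g)
  have key : ∀ a, π.asAlgebraHom a x = MonoidAlgebra.lift k k G 1 a • x := by
    intro a
    induction a using MonoidAlgebra.induction_linear with
    | zero => simp
    | add y z hy hz => rw [map_add, map_add, LinearMap.add_apply, hy, hz, add_smul]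
    | single g c =>
      rw [Representation.asAlgebraHom_single, LinearMap.smul_apply, hfix, MonoidAlgebra.lift_single]
      simp
  exact hx (eq_zero_of_charpoly_eq ρ π h ha (by rw [key, ha1, one_smul]))

end GroupAlgebra

section Charpoly

open Module.End

variable {k : Type*} [Field k] {V : Type*} [AddCommGroup V] [Module k V]

theorem mem_maxGenEigenspace_of_sub_smul_mem {f : Module.End k V} {c : k} {v : V}
    (h : f v - c • v ∈ f.maxGenEigenspace c) : v ∈ f.maxGenEigenspace c := by
  rw [mem_maxGenEigenspace] at h ⊢
  obtain ⟨n, hn⟩ := h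
  refine ⟨n + 1, ?_⟩
  rw [pow_succ, Module.End.mul_apply]
  exact hn

variable {K : Type*} [Field K] [Algebra k K]

open TensorProduct in
/-- If `R` intertwines two operators up to the action of the second one on the parameter, and `s`
is in the generalized eigenspace of the second one for the eigenvalue `1`, then `R s` preserves the
generalized eigenspaces, over any extension. -/
theorem baseChange_mem_maxGenEigenspace (R : V →ₗ[k] Module.End k V) (π ρ : Module.End k V)
    (hR : ∀ s x, ρ (R s x) = R (ρ s) (π x)) (c : K) (n : ℕ) :
    ∀ a b, a + b ≤ n → ∀ (s : V) (x : K ⊗[k] V), ((ρ - 1) ^ a) s = 0 →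
      ((π.baseChange K - c • 1) ^ b) x = 0 →
      (R s).baseChange K x ∈ maxGenEigenspace (ρ.baseChange K) c := by
  have hRK : ∀ s x, ρ.baseChange K ((R s).baseChange K x) =
      (R (ρ s)).baseChange K (π.baseChange K x) := by
    intro s x
    rw [← LinearMap.comp_apply, ← LinearMap.comp_apply, ← LinearMap.baseChange_comp,
      ← LinearMap.baseChange_comp]
    congr 2
    exact LinearMap.ext (hR s)
  induction n with
  | zero =>
    intro a b hab s x hs _
    obtain rfl : a = 0 := by omega
    obtain rfl : s = 0 := by simpa using hs
    simp
  | succ n ih =>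
    intro a b hab s x hs hx
    rcases a with _ | a
    · obtain rfl : s = 0 := by simpa using hs
      simp
    rcases b with _ | b
    · obtain rfl : x = 0 := by simpa using hx
      simp
    refine mem_maxGenEigenspace_of_sub_smul_mem ?_
    have h1 : ρ.baseChange K ((R s).baseChange K x) - c • (R s).baseChange K x =
        (R ((ρ - 1) s)).baseChange K (π.baseChange K x) +
          (R s).baseChange K ((π.baseChange K - c • 1) x) := by
      rw [hRK, LinearMap.sub_apply, map_sub, LinearMap.baseChange_sub, LinearMap.sub_apply,
        LinearMap.sub_apply, map_sub, LinearMap.smul_apply, map_smul]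
      simp
    rw [h1]
    refine Submodule.add_mem _ (ih a (b + 1) (by omega) _ _ ?_ ?_) (ih (a + 1) b (by omega) _ _ hs ?_)
    · rwa [← Module.End.mul_apply, ← pow_succ]
    · have hcomm : Commute (π.baseChange K) ((π.baseChange K - c • 1) ^ (b + 1)) :=
        Commute.pow_right (LinearMap.ext fun y => by simp [Module.End.mul_apply]) _
      rw [← Module.End.mul_apply, ← hcomm.eq, Module.End.mul_apply, hx, map_zero]
    · rwa [← Module.End.mul_apply, ← pow_succ]

theorem charpoly_eq_of_intertwining [FiniteDimensional k V] (R : V →ₗ[k] Module.End k V)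
    (π ρ : Module.End k V) (hR : ∀ s x, ρ (R s x) = R (ρ s) (π x)) {s : V} {a : ℕ}
    (hs : ((ρ - 1) ^ a) s = 0) (hinj : Function.Injective (R s)) : ρ.charpoly = π.charpoly := by
  classical
  let K := AlgebraicClosure k
  have hinjK : Function.Injective ((R s).baseChange K) := by
    have := Module.Flat.lTensor_preserves_injective_linearMap (M := K) (R s) hinj
    exact this
  have hmult : ∀ c, (π.baseChange K).charpoly.rootMultiplicity c ≤
      (ρ.baseChange K).charpoly.rootMultiplicity c := by
    intro c
    rw [← LinearMap.finrank_maxGenEigenspace_eq, ← LinearMap.finrank_maxGenEigenspace_eq,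
      (Submodule.equivMapOfInjective _ hinjK _).finrank_eq]
    refine Submodule.finrank_mono ?_
    rintro _ ⟨x, hx, rfl⟩
    obtain ⟨b, hb⟩ := mem_maxGenEigenspace _ _ _ |>.1 hx
    exact baseChange_mem_maxGenEigenspace R π ρ hR c _ a b le_rfl s x hs hb
  have hle : (π.baseChange K).charpoly.roots ≤ (ρ.baseChange K).charpoly.roots := by
    rw [Multiset.le_iff_count]
    intro c
    rw [Polynomial.count_roots, Polynomial.count_roots]
    exact hmult c
  have hs1 := IsAlgClosed.splits (π.baseChange K).charpoly
  have hs2 := IsAlgClosed.splits (ρ.baseChange K).charpoly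
  have heq := Multiset.eq_of_le_of_card_le hle (by
    rw [← hs1.natDegree_eq_card_roots, ← hs2.natDegree_eq_card_roots,
      LinearMap.charpoly_natDegree, LinearMap.charpoly_natDegree])
  have h1 := hs1.eq_prod_roots_of_monic (LinearMap.charpoly_monic _)
  have h2 := hs2.eq_prod_roots_of_monic (LinearMap.charpoly_monic _)
  rw [heq, ← h2, LinearMap.charpoly_baseChange, LinearMap.charpoly_baseChange] at h1
  exact (Polynomial.map_injective _ (algebraMap k K).injective h1).symm

end Charpoly

/-! ### Operators normalizing the left multiplications by pure octonions -/

namespace OctonionAlgebra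

variable {k : Type u} [Field k] {C : Type v} [AddCommGroup C] [Module k C]

/-- The operator `T` on `C` normalizes left multiplications by pure octonions: there is a map `π`
of the pure octonions to themselves such that `T (x b) = π(x) T(b)`. -/
def NormalizesPure (O : OctonionAlgebra k C) (T : Module.End k C) : Prop :=
  ∀ x ∈ O.pure, ∃ y ∈ O.pure, ∀ b, T (O.mul x b) = O.mul y (T b)

/-- An injective operator normalizing left multiplications by pure octonions is a similitude. -/
theorem NormalizesPure.q_apply {O : OctonionAlgebra k C} {T : Module.End k C}
    (hT : O.NormalizesPure T) (hinj : Function.Injective T) (s : C) :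
    O.q (T s) = O.q (T O.e) * O.q s := by
  have key : ∀ x ∈ O.pure, ∀ b, O.q (T (O.mul x b)) = O.q x * O.q (T b) := by
    intro x hx b
    obtain ⟨y, hy, h⟩ := hT x hx
    have h1 := h (O.mul x O.e)
    rw [h O.e, O.pure_mul_mul_self hx, O.pure_mul_mul_self hy, map_neg, map_smul, neg_inj,
      eq_comm] at h1
    have h0 : T O.e ≠ 0 := fun h0 => O.e_ne_zero (hinj (h0.trans (map_zero T).symm))
    have h2 : O.q y = O.q x := by
      rw [← sub_eq_zero, ← sub_smul, smul_eq_zero_iff_left h0] at h1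
      exact sub_eq_zero.1 h1
    rw [h, O.q_mul, h2]
  obtain ⟨x, hx, y, hy, -, rfl⟩ := O.exists_pure_mul_pure s
  have h := key y hy O.e
  rw [O.mul_e] at h
  rw [key x hx, h, O.q_mul]
  ring

theorem NormalizesPure.q_apply_e_ne_zero {O : OctonionAlgebra k C} {T T' : Module.End k C}
    (hT : O.NormalizesPure T) (h1 : T * T' = 1) (h2 : T' * T = 1) : O.q (T O.e) ≠ 0 := by
  intro h0
  have hinj : Function.Injective T := fun a b hab => by
    have := congrArg T' hab
    rwa [← Module.End.mul_apply, ← Module.End.mul_apply, h2] at this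
  have h := hT.q_apply hinj (T' O.e)
  rw [← Module.End.mul_apply, h1, h0, zero_mul, Module.End.one_apply, O.q_e] at h
  exact one_ne_zero h

/-- An invertible operator normalizing left multiplications by pure octonions normalizes all left
multiplications. If `2 ≠ 0`, this holds because `C` is the sum of its pure octonions and of the line
of the unit. If `2 = 0`, the unit is a pure octonion, and the conjugate of the left multiplication
by `z` differs by a scalar from the left multiplication by an octonion `z₀` representing the linear
form `x ↦ β(z, π⁻¹(x))` on the pure octonions, by Schur's lemma. -/
theorem NormalizesPure.apply_mul {O : OctonionAlgebra k C} {T T' : Module.End k C}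
    (hT : O.NormalizesPure T) (hT' : O.NormalizesPure T') (h1 : T * T' = 1) (h2 : T' * T = 1)
    (z b : C) : T (O.mul z b) = O.mul (T (O.mul z (T' O.e))) (T b) := by
  have e1 : ∀ w, T (T' w) = w := fun w => by rw [← Module.End.mul_apply, h1, Module.End.one_apply]
  have e2 : ∀ w, T' (T w) = w := fun w => by rw [← Module.End.mul_apply, h2, Module.End.one_apply]
  have hP : ∀ x ∈ O.pure, T (O.mul x (T' O.e)) ∈ O.pure ∧
      ∀ b, T (O.mul x b) = O.mul (T (O.mul x (T' O.e))) (T b) := by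
    intro x hx
    obtain ⟨y, hy, h⟩ := hT x hx
    have : T (O.mul x (T' O.e)) = y := by rw [h, e1, O.mul_e]
    rw [this]
    exact ⟨hy, h⟩
  by_cases h20 : (2 : k) = 0
  swap
  · have hz : z = (2⁻¹ * O.β z O.e) • O.e + (z - (2⁻¹ * O.β z O.e) • O.e) := by abel
    have hzP : z - (2⁻¹ * O.β z O.e) • O.e ∈ O.pure := by
      rw [mem_pure, β_sub_left, β_smul_left, β_e_e]
      field_simp
      ring
    rw [hz]
    simp only [map_add, LinearMap.add_apply]
    rw [(hP _ hzP).2 b, map_smul, LinearMap.smul_apply, LinearMap.smul_apply, O.e_mul, O.e_mul,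
      map_smul, map_smul, e1, map_smul, LinearMap.smul_apply, O.e_mul]
  · have heP := O.e_mem_pure h20
    let π' : C →ₗ[k] C := T' ∘ₗ O.mul.flip (T O.e)
    have hπ'_apply : ∀ x, π' x = T' (O.mul x (T O.e)) := fun _ => rfl
    have hπ' : ∀ y ∈ O.pure, π' y ∈ O.pure ∧ ∀ b, T (O.mul (π' y) b) = O.mul y (T b) := by
      intro y hy
      obtain ⟨x, hx, h⟩ := hT' y hy
      have : π' y = x := by rw [hπ'_apply, h, e2, O.mul_e]
      rw [this]
      refine ⟨hx, fun b => ?_⟩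
      rw [← e1 (O.mul y (T b)), h, e2]
    have hπ'e : π' O.e = O.e := by rw [hπ'_apply, O.e_mul, e2]
    obtain ⟨z₀, hz₀⟩ := O.exists_β_eq ((O.q.polarBilin z ∘ₗ π') ∘ₗ O.pure.subtype)
    have hz₀' : ∀ y ∈ O.pure, O.β z₀ y = O.β z (π' y) := fun y hy => hz₀ ⟨y, hy⟩
    have hanti : ∀ x ∈ O.pure, ∀ z w, O.mul z (O.mul x w) =
        O.β z O.e • O.mul x w - O.mul x (O.mul z w) - O.β z x • w := by
      intro x hx z w
      have h := O.mul_conj_mul_add x z w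
      rw [O.conj_apply z, O.conj_eq_neg hx, O.β_comm x z] at h
      rw [← h]
      simp only [map_sub, map_smul, map_neg, LinearMap.sub_apply, LinearMap.smul_apply,
        LinearMap.neg_apply, O.e_mul]
      abel
    let D : Module.End k C := T ∘ₗ O.mul z ∘ₗ T' - O.mul z₀
    have hD_apply : ∀ w, D w = T (O.mul z (T' w)) - O.mul z₀ w := fun _ => rfl
    have hD : ∀ y ∈ O.pure, ∀ w, D (O.mul y w) = -O.mul y (D w) := by
      intro y hy w
      obtain ⟨hx, hxy⟩ := hπ' y hy
      have h3 : T' (O.mul y w) = O.mul (π' y) (T' w) := by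
        rw [← e2 (O.mul (π' y) (T' w)), hxy, e1]
      have h4 : O.β z₀ O.e = O.β z O.e := by rw [hz₀' _ heP, hπ'e]
      rw [hD_apply, hD_apply, h3, hanti _ hx, hanti _ hy, hz₀' y hy, h4, map_sub, map_sub, map_smul,
        map_smul, hxy, hxy, e1, map_sub]
      abel
    obtain ⟨c, hc⟩ := O.exists_eq_smul_of_commute (D := D) fun x hx y hy w => by
      rw [hD x hx, hD y hy, map_neg, neg_neg]
    have hmul : ∀ w, T (O.mul z (T' w)) = O.mul (z₀ + c • O.e) w := by
      intro w
      rw [map_add, map_smul, LinearMap.add_apply, LinearMap.smul_apply, O.e_mul, ← hc, hD_apply]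
      abel
    rw [hmul O.e, O.mul_e, ← hmul, e2]

/-! ### Fixed vectors of groups of spinor isometries -/

theorem β_pow_sub_one (O : OctonionAlgebra k C) {T : Module.End k C}
    (hT : ∀ x y, O.β (T x) (T y) = O.β x y) (n : ℕ) (x y : C) :
    O.β x (((T - 1) ^ n) y) = (-1) ^ n * O.β (((T - 1) ^ n) x) ((T ^ n) y) := by
  induction n generalizing x y with
  | zero => simp
  | succ n ih =>
    have h1 : ∀ x y, O.β x ((T - 1) y) = -O.β ((T - 1) x) (T y) := by
      intro x y
      rw [LinearMap.sub_apply, LinearMap.sub_apply, β_sub_right, β_sub_left, hT]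
      simp
    rw [pow_succ (T - 1), Module.End.mul_apply, ih, pow_succ' T, Module.End.mul_apply]
    have h2 : (T ^ n) ((T - 1) y) = (T - 1) ((T ^ n) y) := by
      rw [← Module.End.mul_apply, ← Module.End.mul_apply]
      congr 1
      exact ((Commute.refl T).pow_left n).sub_right (Commute.one_right _)
    have h3 : ((T - 1) ^ n) ((T - 1) x) = (T - 1) (((T - 1) ^ n) x) := by
      rw [← Module.End.mul_apply, ← Module.End.mul_apply, ← pow_succ, ← pow_succ']
    rw [h2, h3, h1, pow_succ, Module.End.mul_apply]
    ring

/-- The generalized eigenspace of an isometry for the eigenvalue `1` contains an anisotropic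
vector, since it is orthogonal to its Fitting complement. -/
theorem exists_q_ne_zero_pow_sub_one_apply_eq_zero (O : OctonionAlgebra k C) {T : Module.End k C}
    (hT : ∀ x y, O.β (T x) (T y) = O.β x y) (h1 : T.HasEigenvalue 1) :
    ∃ (n : ℕ) (s : C), ((T - 1) ^ n) s = 0 ∧ O.q s ≠ 0 := by
  have := O.finiteDimensional
  by_contra! hne
  obtain ⟨w, hw⟩ := h1.exists_hasEigenvector
  obtain ⟨N, hN⟩ := Filter.eventually_atTop.1
    (LinearMap.eventually_isCompl_ker_pow_range_pow (T - 1))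
  have hcompl := hN (N + 1) (Nat.le_succ N)
  have hw1 : ((T - 1) ^ (N + 1)) w = 0 := by
    rw [pow_succ, Module.End.mul_apply, LinearMap.sub_apply, hw.apply_eq_smul]
    simp
  refine hw.2 (O.ext_β fun z => ?_)
  rw [β_zero_left]
  have hz : z ∈ LinearMap.ker ((T - 1) ^ (N + 1)) ⊔ LinearMap.range ((T - 1) ^ (N + 1)) := by
    rw [hcompl.sup_eq_top]; trivial
  obtain ⟨a, ha, _, ⟨b, rfl⟩, rfl⟩ := Submodule.mem_sup.1 hz
  rw [β_add_right, O.β_pow_sub_one hT, hw1, β_zero_left, mul_zero, add_zero]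
  exact O.β_eq_zero_of_q_eq_zero (N := LinearMap.ker ((T - 1) ^ (N + 1)))
    (fun n hn => hne _ n hn) hw1 ha

variable {G : Type w} [Group G]

/-- The fixed vectors of a semisimple representation by isometries form a nondegenerate space. -/
theorem exists_fixed_q_ne_zero (O : OctonionAlgebra k C) (ρ : Representation k G C)
    (hss : ρ.IsSemisimpleRepresentation) (hβ : ∀ g x y, O.β (ρ g x) (ρ g y) = O.β x y)
    {w : C} (hw0 : w ≠ 0) (hw : ∀ g, ρ g w = w) : ∃ s, O.q s ≠ 0 ∧ ∀ g, ρ g s = s := by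
  by_contra! hne
  let I : Subrepresentation ρ := ⟨⨅ g, LinearMap.eqLocus (ρ g) LinearMap.id, fun g v hv => by
    rw [Submodule.mem_iInf] at hv
    have : ρ g v = v := hv g
    rwa [this, Submodule.mem_iInf]⟩
  have hI : ∀ v, v ∈ I.toSubmodule ↔ ∀ g, ρ g v = v := fun v => Submodule.mem_iInf _
  obtain ⟨J, hJ⟩ := exists_isCompl I
  have hIJ : ∀ v, v ∈ I.toSubmodule → v ∈ J.toSubmodule → v = 0 := fun v h1 h2 => by
    have : v ∈ (I ⊓ J).toSubmodule := ⟨h1, h2⟩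
    rw [hJ.inf_eq_bot] at this
    exact this
  let J₀ : Subrepresentation ρ := ⟨J.toSubmodule ⊓ LinearMap.ker (O.q.polarBilin w),
    fun g v hv => ⟨J.apply_mem_toSubmodule g hv.1, by
      change O.β w _ = 0
      rw [← hw g, hβ]
      exact hv.2⟩⟩
  obtain ⟨J₁, hJ₁⟩ := exists_isCompl J₀
  have hdec : ∀ {A B : Subrepresentation ρ}, IsCompl A B → ∀ v,
      ∃ a ∈ A.toSubmodule, ∃ b ∈ B.toSubmodule, a + b = v := fun {A B} hAB v => by
    have : v ∈ (A ⊔ B).toSubmodule := by rw [hAB.sup_eq_top]; trivial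
    exact Submodule.mem_sup.1 this
  have hJJ₀ : ∀ j ∈ J.toSubmodule, O.β w j = 0 := by
    intro j hj
    obtain ⟨a, ha, b, hb, rfl⟩ := hdec hJ₁ j
    have hbJ : b ∈ J.toSubmodule := by
      have := J.toSubmodule.sub_mem hj ha.1
      rwa [add_sub_cancel_left] at this
    -- `ρ g b - b` is in `J`, in `J₁` and orthogonal to `w`
    have hb0 : b = 0 := hIJ b ((hI b).2 fun g => by
      have h1 : ρ g b - b ∈ (J₀ ⊓ J₁).toSubmodule := by
        refine ⟨⟨J.toSubmodule.sub_mem (J.apply_mem_toSubmodule g hbJ) hbJ, ?_⟩,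
          J₁.toSubmodule.sub_mem (J₁.apply_mem_toSubmodule g hb) hb⟩
        change O.β w _ = 0
        rw [β_sub_right, sub_eq_zero]
        nth_rewrite 1 [← hw g]
        exact hβ g w b
      rw [hJ₁.inf_eq_bot] at h1
      exact sub_eq_zero.1 h1) hbJ
    rw [hb0, add_zero]
    exact ha.2
  refine hw0 (O.ext_β fun z => ?_)
  obtain ⟨a, ha, b, hb, rfl⟩ := hdec hJ z
  have hq : ∀ n ∈ I.toSubmodule, O.q n = 0 := fun n hn => by
    by_contra h0
    obtain ⟨g, hg⟩ := hne n h0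
    exact hg ((hI n).1 hn g)
  rw [β_add_right, hJJ₀ b hb, O.β_eq_zero_of_q_eq_zero hq ((hI w).2 hw) ha, β_zero_left, add_zero]

theorem exists_fixed_of_hasEigenvalue (O : OctonionAlgebra k C) (ρ : Representation k G C)
    (hss : ρ.IsSemisimpleRepresentation) (hβ : ∀ g x y, O.β (ρ g x) (ρ g y) = O.β x y)
    (hρ : ∀ g, O.NormalizesPure (ρ g)) (h1 : ∀ g, Module.End.HasEigenvalue (ρ g) 1) :
    ∃ s, O.q s ≠ 0 ∧ ∀ g, ρ g s = s := by
  have := O.finiteDimensional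
  have hmul : ∀ g z b, ρ g (O.mul z b) = O.mul (ρ g (O.mul z (ρ g⁻¹ O.e))) (ρ g b) :=
    fun g z b => (hρ g).apply_mul (hρ g⁻¹) (by rw [← map_mul, mul_inv_cancel, map_one])
      (by rw [← map_mul, inv_mul_cancel, map_one]) z b
  have hinv : ∀ g z, ρ g (ρ g⁻¹ z) = z := fun g z => by
    rw [← Module.End.mul_apply, ← map_mul, mul_inv_cancel, map_one, Module.End.one_apply]
  let π : Representation k G C :=
    { toFun := fun g => ρ g ∘ₗ O.mul.flip (ρ g⁻¹ O.e)
      map_one' := LinearMap.ext fun x => by simp [O.mul_e]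
      map_mul' := fun g h => LinearMap.ext fun x => by
        simp only [map_mul, mul_inv_rev, LinearMap.comp_apply, LinearMap.flip_apply,
          Module.End.mul_apply]
        rw [hmul h x, hinv] }
  have hπ : ∀ g x, π g x = ρ g (O.mul x (ρ g⁻¹ O.e)) := fun _ _ => rfl
  obtain ⟨w, hw0, hw⟩ := exists_fixed_of_charpoly_eq ρ hss π (fun g => by
    obtain ⟨n, s, hs, hq⟩ := O.exists_q_ne_zero_pow_sub_one_apply_eq_zero (hβ g) (h1 g)
    exact charpoly_eq_of_intertwining O.mul.flip (π g) (ρ g) (fun s x => hmul g x s) hs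
      (O.mul_flip_injective_of_q_ne_zero hq)) O.e_ne_zero
    (fun g => by rw [hπ, O.e_mul, hinv])
  exact O.exists_fixed_q_ne_zero ρ hss hβ hw0 hw

end OctonionAlgebra

/-! ### The spinor representation -/

namespace OctonionAlgebra

open CliffordAlgebra

variable {k : Type u} [Field k] {C : Type v} [AddCommGroup C] [Module k C]
variable {V : Type w} [AddCommGroup V] [Module k V] {Q : QuadraticForm k V}

theorem ellClifford_ι (O : OctonionAlgebra k C) (x : C) :
    O.ellClifford (ι O.q x) = O.ell x := lift_ι_apply _ _ _

/-- The two half-spinor modules of `C` coincide over the even Clifford algebra of the pure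
octonions, because `x̄ = -x` for `x` pure. -/
theorem evenToEnd_apply (O : OctonionAlgebra k C) (f : Q →qᵢ O.q) (hf : ∀ x, f x ∈ O.pure)
    (g : even Q) (a b : C) : O.evenToEnd f g (a, b) = (O.spinRep f g a, O.spinRep f g b) := by
  have key : ∀ b, O.evenToEnd f g (0, b) = (0, O.spinRep f g b) := by
    intro b
    change O.evenToEnd f g (0, b) = (0, (O.evenToEnd f g (b, 0)).1)
    obtain ⟨g, hg⟩ := g
    change O.ellClifford (CliffordAlgebra.map f g) (0, b) =
      (0, (O.ellClifford (CliffordAlgebra.map f g) (b, 0)).1)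
    induction g, hg using CliffordAlgebra.even_induction with
    | algebraMap r => simp
    | add x y hx hy ihx ihy => simp [ihx, ihy]
    | ι_mul_ι_mul m₁ m₂ x hx ih =>
      have h0 : (O.ellClifford (CliffordAlgebra.map f x) (b, 0)).2 = 0 :=
        O.evenToEnd_snd f ⟨x, hx⟩ b
      simp [ellClifford_ι, ih, O.conj_eq_neg (hf _)]
  have h1 : O.evenToEnd f g (a, 0) = (O.spinRep f g a, 0) :=
    Prod.ext rfl (O.evenToEnd_snd f g a)
  rw [← add_zero a, ← zero_add b, ← Prod.mk_add_mk, map_add, h1, key]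
  simp

theorem spinRep_ι_mul_ι (O : OctonionAlgebra k C) (f : Q →qᵢ O.q) (hf : ∀ x, f x ∈ O.pure)
    (x y : V) (a : C) :
    O.spinRep f ((even.ι Q).bilin x y) a = -O.mul (f x) (O.mul (f y) a) := by
  change (O.ellClifford (CliffordAlgebra.map f (ι Q x * ι Q y)) (a, 0)).1 = _
  simp [ellClifford_ι, O.conj_eq_neg (hf _)]

/-- The semilinearity of the spinor representation with respect to the vector representation. -/
theorem spinRep_mul (O : OctonionAlgebra k C) (f : Q →qᵢ O.q) (hf : ∀ x, f x ∈ O.pure)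
    {g : even Q} {x y : V} (h : (g : CliffordAlgebra Q) * ι Q x = ι Q y * g) (b : C) :
    O.spinRep f g (O.mul (f x) b) = O.mul (f y) (O.spinRep f g b) := by
  have h1 := congrArg (fun c => (O.ellClifford (CliffordAlgebra.map f c) (0, b)).1) h
  simp only [map_mul, map_apply_ι, ellClifford_ι, Module.End.mul_apply, ell_apply, map_zero] at h1
  have h2 := O.evenToEnd_apply f hf g
  change ∀ a b, O.ellClifford (CliffordAlgebra.map f g) (a, b) = _ at h2
  rw [h2, h2] at h1
  exact h1

theorem normalizesPure_spinRep (O : OctonionAlgebra k C) (f : Q →qᵢ O.q)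
    (hf : LinearMap.range f.toLinearMap = O.pure) {g : (even Q)ˣ} (hg : g ∈ GSpinGroup Q) :
    O.NormalizesPure (O.spinRep f g) := by
  have hf' : ∀ x, f x ∈ O.pure := fun x => hf ▸ ⟨x, rfl⟩
  intro x hx
  rw [← hf] at hx
  obtain ⟨x, rfl⟩ := hx
  obtain ⟨y, hy⟩ := (hg x).1
  refine ⟨f y, hf' y, fun b => O.spinRep_mul f hf' ?_ b⟩
  rw [← hy, mul_assoc, ← Subalgebra.coe_mul, Units.inv_mul]
  simp

theorem spinRep_mul_inv (O : OctonionAlgebra k C) (f : Q →qᵢ O.q) (g : (even Q)ˣ) :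
    O.spinRep f g * O.spinRep f (g⁻¹ : (even Q)ˣ) = 1 := by
  rw [← map_mul, Units.mul_inv, map_one]

theorem spinRep_inv_mul (O : OctonionAlgebra k C) (f : Q →qᵢ O.q) (g : (even Q)ˣ) :
    O.spinRep f (g⁻¹ : (even Q)ˣ) * O.spinRep f g = 1 := by
  rw [← map_mul, Units.inv_mul, map_one]

theorem spinRep_inv_apply_apply (O : OctonionAlgebra k C) (f : Q →qᵢ O.q) (g : (even Q)ˣ) (a : C) :
    O.spinRep f (g⁻¹ : (even Q)ˣ) (O.spinRep f g a) = a := by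
  rw [← Module.End.mul_apply, spinRep_inv_mul, Module.End.one_apply]

theorem spinRep_apply_inv_apply (O : OctonionAlgebra k C) (f : Q →qᵢ O.q) (g : (even Q)ˣ) (a : C) :
    O.spinRep f g (O.spinRep f (g⁻¹ : (even Q)ˣ) a) = a := by
  rw [← Module.End.mul_apply, spinRep_mul_inv, Module.End.one_apply]

theorem reverse_map_apply {M : Type*} [AddCommGroup M] [Module k M] {Q' : QuadraticForm k M}
    (f : Q →qᵢ Q') (c : CliffordAlgebra Q) :
    reverse (CliffordAlgebra.map f c) = CliffordAlgebra.map f (reverse c) := by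
  induction c using CliffordAlgebra.induction with
  | algebraMap t => simp
  | ι x => simp
  | mul a b iha ihb => simp [iha, ihb]
  | add a b iha ihb => simp [iha, ihb]

/-- The canonical anti-involution of the Clifford algebra is the adjunction for the orthogonal sum
of two copies of the polar form. -/
theorem β_ellClifford (O : OctonionAlgebra k C) (c : CliffordAlgebra O.q) (p r : C × C) :
    O.β (O.ellClifford c p).1 r.1 + O.β (O.ellClifford c p).2 r.2 =
      O.β p.1 (O.ellClifford (reverse c) r).1 + O.β p.2 (O.ellClifford (reverse c) r).2 := by
  induction c using CliffordAlgebra.induction generalizing p r with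
  | algebraMap t => simp [β_smul_left, β_smul_right]
  | ι x =>
    rw [reverse_ι, ellClifford_ι, ell_apply, ell_apply]
    dsimp only
    rw [β_mul_left_eq, O.β_mul_left_eq (O.conj x), conj_conj]
    ring
  | mul a b iha ihb =>
    rw [reverse.map_mul, map_mul, map_mul, Module.End.mul_apply, Module.End.mul_apply, iha, ihb]
  | add a b iha ihb =>
    simp only [map_add, LinearMap.add_apply, Prod.fst_add, Prod.snd_add, β_add_left, β_add_right]
    linear_combination iha p r + ihb p r

theorem β_spinRep (O : OctonionAlgebra k C) (f : Q →qᵢ O.q) (hf : ∀ x, f x ∈ O.pure)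
    {g : (even Q)ˣ} (hg : g ∈ SpinGroup Q) (a b : C) :
    O.β (O.spinRep f g a) (O.spinRep f g b) = O.β a b := by
  have h1 : reverse ((g : even Q) : CliffordAlgebra Q) * (g : even Q) = 1 := by
    have h2 : (((g⁻¹ : (even Q)ˣ) : even Q) : CliffordAlgebra Q) * (g : even Q) = 1 := by
      rw [← Subalgebra.coe_mul, Units.inv_mul, Subalgebra.coe_one]
    rw [← left_inv_eq_right_inv h2 hg.2, h2]
  have h := O.β_ellClifford (CliffordAlgebra.map f (g : even Q)) (a, 0) (O.spinRep f g b, 0)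
  have h3 := O.evenToEnd_apply f hf g
  change ∀ a b, O.ellClifford (CliffordAlgebra.map f (g : even Q)) (a, b) = _ at h3
  have h4 : O.ellClifford (reverse (CliffordAlgebra.map f (g : even Q)))
      (O.spinRep f g b, 0) = (b, 0) := by
    have h5 := h3 b 0
    rw [map_zero] at h5
    rw [← h5, ← Module.End.mul_apply, ← map_mul]
    have h6 : reverse (CliffordAlgebra.map f (g : even Q)) =
        CliffordAlgebra.map f (reverse ((g : even Q) : CliffordAlgebra Q)) := by
      exact reverse_map_apply f _
    rw [h6, ← map_mul, h1, map_one, map_one, Module.End.one_apply]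
  rw [h3, h4] at h
  simpa [β_zero_left, β_zero_right] using h

/-- The elements of `Spin(V)` whose image in the spinor representation fixes the unit act as
automorphisms. -/
theorem mem_g2Image (O : OctonionAlgebra k C) (f : Q →qᵢ O.q)
    (hf : LinearMap.range f.toLinearMap = O.pure) {g : (even Q)ˣ} (hg : g ∈ SpinGroup Q) :
    g ∈ O.g2Image f ↔ O.spinRep f g O.e = O.e := by
  have hf' : ∀ x, f x ∈ O.pure := fun x => hf ▸ ⟨x, rfl⟩
  constructor
  · rintro ⟨-, φ, hφ⟩
    have h1 := congrArg (fun u : (Module.End k (C × C))ˣ =>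
      ((u : Module.End k (C × C)) (O.e, 0)).1) hφ
    change (φ : C ≃ₗ[k] C) O.e = O.spinRep f g O.e at h1
    rw [← h1]
    have h2 : ∀ y, O.mul ((φ : C ≃ₗ[k] C) O.e) y = y := fun y => by
      obtain ⟨x, rfl⟩ := (φ : C ≃ₗ[k] C).surjective y
      rw [← φ.2, O.e_mul]
    rw [← O.mul_e ((φ : C ≃ₗ[k] C) O.e), h2]
  · intro he
    refine ⟨hg, ?_⟩
    have he' : O.spinRep f (g⁻¹ : (even Q)ˣ) O.e = O.e := by
      conv_lhs => rw [← he]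
      exact O.spinRep_inv_apply_apply f g _
    have hmul : ∀ a b, O.spinRep f g (O.mul a b) =
        O.mul (O.spinRep f g a) (O.spinRep f g b) := fun a b => by
      have h := (O.normalizesPure_spinRep f hf hg.1).apply_mul
        (O.normalizesPure_spinRep f hf (inv_mem hg.1)) (O.spinRep_mul_inv f g)
        (O.spinRep_inv_mul f g) a b
      rwa [he', O.mul_e] at h
    refine ⟨⟨LinearEquiv.ofLinearMap (O.spinRep f g) (O.spinRep f (g⁻¹ : (even Q)ˣ))
      (O.spinRep_mul_inv f g) (O.spinRep_inv_mul f g), hmul⟩, ?_⟩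
    ext1
    refine LinearMap.ext fun p => ?_
    exact (O.evenToEnd_apply f hf' g p.1 p.2).symm

end OctonionAlgebra

/-! ### Conjugation in the general spin group -/

section GSpin

open CliffordAlgebra

variable {k : Type u} [Field k] {V : Type w} [AddCommGroup V] [Module k V] {Q : QuadraticForm k V}

/-- The product of two anisotropic vectors, as a unit of the even Clifford algebra. -/
def evenPairUnit (Q : QuadraticForm k V) (x y : V) (hx : Q x ≠ 0) (hy : Q y ≠ 0) :
    (even Q)ˣ where
  val := (even.ι Q).bilin x y
  inv := (Q x * Q y)⁻¹ • (even.ι Q).bilin y x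
  val_inv := by
    rw [mul_smul_comm, EvenHom.contract_mid, EvenHom.contract, Algebra.algebraMap_eq_smul_one,
      smul_smul, smul_smul, mul_assoc, mul_comm (Q y), inv_mul_cancel₀ (mul_ne_zero hx hy),
      one_smul]
  inv_val := by
    rw [smul_mul_assoc, EvenHom.contract_mid, EvenHom.contract, Algebra.algebraMap_eq_smul_one,
      smul_smul, smul_smul, mul_assoc, inv_mul_cancel₀ (mul_ne_zero hx hy), one_smul]

theorem coe_evenPairUnit (x y : V) (hx : Q x ≠ 0) (hy : Q y ≠ 0) :
    ((evenPairUnit Q x y hx hy : even Q) : CliffordAlgebra Q) = ι Q x * ι Q y := rfl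

theorem coe_evenPairUnit_inv (x y : V) (hx : Q x ≠ 0) (hy : Q y ≠ 0) :
    ((((evenPairUnit Q x y hx hy)⁻¹ : (even Q)ˣ) : even Q) : CliffordAlgebra Q) =
      (Q x * Q y)⁻¹ • (ι Q y * ι Q x) := rfl

theorem evenPairUnit_mem_GSpinGroup (x y : V) (hx : Q x ≠ 0) (hy : Q y ≠ 0) :
    evenPairUnit Q x y hx hy ∈ GSpinGroup Q := by
  have key : ∀ a b z : V, ∃ w, ι Q a * ι Q b * ι Q z * (ι Q b * ι Q a) = ι Q w := by
    intro a b z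
    have h : ι Q a * ι Q b * ι Q z * (ι Q b * ι Q a) =
        ι Q a * (ι Q b * ι Q z * ι Q b) * ι Q a := by
      simp only [mul_assoc]
    rw [h, ι_mul_ι_mul_ι, ι_mul_ι_mul_ι]
    exact ⟨_, rfl⟩
  intro z
  rw [coe_evenPairUnit, coe_evenPairUnit_inv]
  constructor
  · obtain ⟨w, hw⟩ := key x y z
    exact ⟨(Q x * Q y)⁻¹ • w, by rw [mul_smul_comm, hw, map_smul]⟩
  · obtain ⟨w, hw⟩ := key y x z
    exact ⟨(Q x * Q y)⁻¹ • w, by rw [smul_mul_assoc, smul_mul_assoc, hw, map_smul]⟩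

theorem conj_evenPairUnit_mem_SpinGroup (x y : V) (hx : Q x ≠ 0) (hy : Q y ≠ 0)
    {γ : (even Q)ˣ} (hγ : γ ∈ SpinGroup Q) :
    (evenPairUnit Q x y hx hy)⁻¹ * γ * evenPairUnit Q x y hx hy ∈ SpinGroup Q := by
  have hg := evenPairUnit_mem_GSpinGroup x y hx hy
  refine ⟨mul_mem (mul_mem (inv_mem hg) hγ.1) hg, ?_⟩
  have e1 : ι Q x * ι Q y * (ι Q y * ι Q x) = (Q x * Q y) • 1 := by
    rw [mul_assoc, ← mul_assoc (ι Q y), ι_sq_scalar, ← mul_assoc, ← Algebra.commutes, mul_assoc,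
      ι_sq_scalar, mul_comm (Q x), Algebra.smul_def, map_mul, mul_one]
  have e2 : ι Q y * ι Q x * (ι Q x * ι Q y) = (Q x * Q y) • 1 := by
    rw [mul_assoc, ← mul_assoc (ι Q x), ι_sq_scalar, ← mul_assoc, ← Algebra.commutes, mul_assoc,
      ι_sq_scalar, Algebra.smul_def, map_mul, mul_one]
  have h := hγ.2
  simp only [Units.val_mul, Subalgebra.coe_mul, coe_evenPairUnit, coe_evenPairUnit_inv,
    reverse.map_mul, map_smul, reverse_ι]
  set a := ι Q x * ι Q y
  set b := ι Q y * ι Q x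
  set c := ((γ : even Q) : CliffordAlgebra Q)
  have h3 : (Q x * Q y)⁻¹ • b * c * a * (b * (reverse c * (Q x * Q y)⁻¹ • a)) =
      ((Q x * Q y)⁻¹ * (Q x * Q y)⁻¹) • (b * (c * (a * b) * reverse c) * a) := by
    simp only [smul_mul_assoc, mul_smul_comm, smul_smul, mul_assoc]
  rw [h3, e1, mul_smul_comm, mul_one, smul_mul_assoc, h, mul_smul_comm, mul_one, smul_mul_assoc,
    e2, smul_smul, smul_smul]
  have := mul_ne_zero hx hy
  rw [show (Q x * Q y)⁻¹ * (Q x * Q y)⁻¹ * (Q x * Q y) * (Q x * Q y) = 1 by field_simp, one_smul]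

end GSpin

namespace OctonionAlgebra

open CliffordAlgebra

variable {k : Type u} [Field k] {C : Type v} [AddCommGroup C] [Module k C]
variable {V : Type w} [AddCommGroup V] [Module k V] {Q : QuadraticForm k V}

/-- The general spin group is transitive on anisotropic vectors: an
anisotropic vector is the product of two anisotropic pure octonions, hence is the image of the unit
by a product of two vectors in the Clifford algebra. -/
theorem exists_conj_mem_g2Image (O : OctonionAlgebra k C) (f : Q →qᵢ O.q)
    (hf : LinearMap.range f.toLinearMap = O.pure) {s : C} (hs : O.q s ≠ 0) :
    ∃ g ∈ GSpinGroup Q, O.spinRep f g s = O.e ∧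
      ∀ γ ∈ SpinGroup Q, O.spinRep f γ s = s → g * γ * g⁻¹ ∈ O.g2Image f := by
  have hf' : ∀ x, f x ∈ O.pure := fun x => hf ▸ ⟨x, rfl⟩
  obtain ⟨x, hx, y, hy, hqx, hqy, rfl⟩ := O.exists_pure_mul_pure_of_q_ne_zero hs
  rw [← hf] at hx hy
  obtain ⟨x, rfl⟩ := hx
  obtain ⟨y, rfl⟩ := hy
  have hQx : Q (-x) ≠ 0 := by
    rw [QuadraticMap.map_neg, ← f.map_app]; exact hqx
  have hQy : Q y ≠ 0 := by
    rw [← f.map_app]; exact hqy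
  set g := evenPairUnit Q (-x) y hQx hQy with hg
  have hge : O.spinRep f g O.e = O.mul (f x) (f y) := by
    change O.spinRep f ((even.ι Q).bilin (-x) y) O.e = _
    rw [O.spinRep_ι_mul_ι f hf', O.mul_e, map_neg]
    simp
  have hgs : O.spinRep f (g⁻¹ : (even Q)ˣ) (O.mul (f x) (f y)) = O.e := by
    rw [← hge, spinRep_inv_apply_apply]
  refine ⟨g⁻¹, inv_mem (evenPairUnit_mem_GSpinGroup _ _ _ _), hgs, fun γ hγ hγs => ?_⟩
  rw [inv_inv, O.mem_g2Image f hf (conj_evenPairUnit_mem_SpinGroup _ _ _ _ hγ), Units.val_mul,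
    Units.val_mul, map_mul, map_mul, Module.End.mul_apply, Module.End.mul_apply, hge]
  exact (congrArg _ hγs).trans hgs

theorem exists_fixed_of_forall_hasEigenvalue (O : OctonionAlgebra k C) (f : Q →qᵢ O.q)
    (hf : LinearMap.range f.toLinearMap = O.pure) {Γ : Subgroup (even Q)ˣ}
    (hΓ : Γ ≤ SpinGroup Q)
    (hss : (cliffordUnitsRep (O.spinRep f) Γ).IsSemisimpleRepresentation)
    (h1 : ∀ γ ∈ Γ, Module.End.HasEigenvalue (O.spinRep f γ) 1) :
    ∃ s : C, O.q s ≠ 0 ∧ ∀ γ ∈ Γ, O.spinRep f γ s = s := by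
  have hf' : ∀ x, f x ∈ O.pure := fun x => hf ▸ ⟨x, rfl⟩
  obtain ⟨s, hs, h⟩ := O.exists_fixed_of_hasEigenvalue (cliffordUnitsRep (O.spinRep f) Γ) hss
    (fun g a b => O.β_spinRep f hf' (hΓ g.2) a b)
    (fun g => O.normalizesPure_spinRep f hf (hΓ g.2).1) (fun g => h1 g g.2)
  exact ⟨s, hs, fun γ hγ => h ⟨γ, hγ⟩⟩

theorem hasEigenvalue_one_iff {W : Type*} [AddCommGroup W] [Module k W] {T : Module.End k W} :
    T.HasEigenvalue 1 ↔ ∃ v ≠ 0, T v = v := by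
  constructor
  · intro h
    obtain ⟨v, hv⟩ := h.exists_hasEigenvector
    exact ⟨v, hv.2, by rw [hv.apply_eq_smul, one_smul]⟩
  · rintro ⟨v, hv, h⟩
    exact Module.End.hasEigenvalue_of_hasEigenvector
      ⟨Module.End.mem_eigenspace_iff.2 (by rw [h, one_smul]), hv⟩

theorem range_pureIncl (O : OctonionAlgebra k C) :
    LinearMap.range O.pureIncl.toLinearMap = O.pure := O.pure.range_subtype

/-- The characterization of the conjugates of subgroups of `G₂(C)` in the group `Spin(P)`. -/
theorem tfae_conj_g2Image (O : OctonionAlgebra k C) (Γ : Subgroup (even O.pureForm)ˣ)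
    (hΓ : Γ ≤ SpinGroup O.pureForm)
    (hss : (cliffordUnitsRep (O.spinRep O.pureIncl) Γ).IsSemisimpleRepresentation) :
    List.TFAE
      [ ∀ γ ∈ Γ, ∃ g ∈ GSpinGroup O.pureForm, g * γ * g⁻¹ ∈ O.g2Image O.pureIncl,
        ∀ γ ∈ Γ, ∃ s : C, O.q s ≠ 0 ∧ O.spinRep O.pureIncl γ s = s,
        ∀ γ ∈ Γ, Module.End.HasEigenvalue (O.spinRep O.pureIncl γ) 1,
        ∃ g ∈ GSpinGroup O.pureForm, ∀ γ ∈ Γ, g * γ * g⁻¹ ∈ O.g2Image O.pureIncl,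
        ∃ s : C, O.q s ≠ 0 ∧ ∀ γ ∈ Γ, O.spinRep O.pureIncl γ s = s ] := by
  tfae_have 1 → 2 := by
    intro h γ hγ
    obtain ⟨g, hg, hmem⟩ := h γ hγ
    have he := (O.mem_g2Image O.pureIncl O.range_pureIncl hmem.1).1 hmem
    rw [Units.val_mul, Units.val_mul, map_mul, map_mul, Module.End.mul_apply,
      Module.End.mul_apply] at he
    refine ⟨O.spinRep O.pureIncl (g⁻¹ : (even O.pureForm)ˣ) O.e, ?_, ?_⟩
    · exact (O.normalizesPure_spinRep O.pureIncl O.range_pureIncl (inv_mem hg)).q_apply_e_ne_zero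
        (O.spinRep_inv_mul _ g) (O.spinRep_mul_inv _ g)
    · nth_rewrite 2 [← he]
      rw [spinRep_inv_apply_apply]
  tfae_have 2 → 3 := by
    intro h γ hγ
    obtain ⟨s, hs, hfix⟩ := h γ hγ
    exact hasEigenvalue_one_iff.2 ⟨s, fun h0 => hs (by rw [h0, map_zero]), hfix⟩
  tfae_have 3 → 5 :=
    O.exists_fixed_of_forall_hasEigenvalue O.pureIncl O.range_pureIncl hΓ hss
  tfae_have 5 → 4 := by
    rintro ⟨s, hs, h⟩
    obtain ⟨g, hg, -, hmem⟩ := O.exists_conj_mem_g2Image O.pureIncl O.range_pureIncl hs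
    exact ⟨g, hg, fun γ hγ => hmem γ (hΓ hγ) (h γ hγ)⟩
  tfae_have 4 → 1 := by
    rintro ⟨g, hg, h⟩ γ hγ
    exact ⟨g, hg, h γ hγ⟩
  tfae_finish

end OctonionAlgebra

/-! ### Dimension bounds for Clifford algebras -/

section Dimension

open CliffordAlgebra

variable {k : Type u} [Field k] {V : Type w} [AddCommGroup V] [Module k V] (Q : QuadraticForm k V)

/-- Adding a vector `v` to the generators of a subalgebra `A` generated by vectors at most doubles
the dimension: the new algebra is `A + A v`. -/
theorem adjoin_insert_ι_le (S : Set V) (v : V) :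
    Subalgebra.toSubmodule (Algebra.adjoin k (ι Q '' (insert v S))) ≤
      Subalgebra.toSubmodule (Algebra.adjoin k (ι Q '' S)) ⊔
        (Subalgebra.toSubmodule (Algebra.adjoin k (ι Q '' S))).map
          (LinearMap.mulRight k (ι Q v)) := by
  set A := Algebra.adjoin k (ι Q '' S) with hA
  set N := Subalgebra.toSubmodule A ⊔
    (Subalgebra.toSubmodule A).map (LinearMap.mulRight k (ι Q v)) with hN
  have hmem : ∀ c, c ∈ N ↔ ∃ a ∈ A, ∃ b ∈ A, a + b * ι Q v = c := by
    intro c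
    rw [hN, Submodule.mem_sup]
    constructor
    · rintro ⟨a, ha, _, ⟨b, hb, rfl⟩, rfl⟩
      exact ⟨a, ha, b, hb, rfl⟩
    · rintro ⟨a, ha, b, hb, rfl⟩
      exact ⟨a, ha, _, ⟨b, hb, rfl⟩, rfl⟩
  have hcomm : ∀ a ∈ A, ι Q v * a ∈ N := by
    intro a ha
    induction ha using Algebra.adjoin_induction with
    | mem x hx =>
      obtain ⟨u, hu, rfl⟩ := hx
      rw [hmem, ι_mul_ι_comm]
      exact ⟨_, A.algebraMap_mem _, -ι Q u, A.neg_mem (Algebra.subset_adjoin ⟨u, hu, rfl⟩),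
        by rw [neg_mul, sub_eq_add_neg]⟩
    | algebraMap r =>
      rw [hmem]
      exact ⟨0, A.zero_mem, _, A.algebraMap_mem r, by rw [zero_add, Algebra.commutes]⟩
    | add a b _ _ iha ihb => rw [mul_add]; exact N.add_mem iha ihb
    | mul a b ha hb iha ihb =>
      obtain ⟨a₁, ha₁, a₂, ha₂, h⟩ := (hmem _).1 iha
      obtain ⟨b₁, hb₁, b₂, hb₂, h'⟩ := (hmem _).1 ihb
      rw [hmem, ← mul_assoc, ← h, add_mul, mul_assoc, ← h']
      exact ⟨a₁ * b + a₂ * b₁, A.add_mem (A.mul_mem ha₁ hb) (A.mul_mem ha₂ hb₁), a₂ * b₂,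
        A.mul_mem ha₂ hb₂, by noncomm_ring⟩
  have hleft : ∀ c ∈ Algebra.adjoin k (ι Q '' (insert v S)), ∀ n ∈ N, c * n ∈ N := by
    intro c hc
    induction hc using Algebra.adjoin_induction with
    | mem x hx =>
      obtain ⟨u, hu, rfl⟩ := hx
      intro n hn
      obtain ⟨a, ha, b, hb, rfl⟩ := (hmem _).1 hn
      rcases hu with rfl | hu
      · obtain ⟨b₁, hb₁, b₂, hb₂, h⟩ := (hmem _).1 (hcomm b hb)
        rw [mul_add, ← mul_assoc, ← h, add_mul, mul_assoc, ι_sq_scalar]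
        refine N.add_mem (hcomm a ha) ((hmem _).2 ⟨b₂ * algebraMap k _ (Q u),
          A.mul_mem hb₂ (A.algebraMap_mem _), b₁, hb₁, add_comm _ _⟩)
      · have huA : ι Q u ∈ A := Algebra.subset_adjoin ⟨u, hu, rfl⟩
        rw [hmem]
        exact ⟨ι Q u * a, A.mul_mem huA ha, ι Q u * b, A.mul_mem huA hb, by
          rw [mul_add, mul_assoc]⟩
    | algebraMap r => intro n hn; rw [← Algebra.smul_def]; exact N.smul_mem r hn
    | add a b _ _ iha ihb => intro n hn; rw [add_mul]; exact N.add_mem (iha n hn) (ihb n hn)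
    | mul a b _ _ iha ihb => intro n hn; rw [mul_assoc]; exact iha _ (ihb n hn)
  intro c hc
  rw [← mul_one c]
  exact hleft c hc 1 ((hmem 1).2 ⟨1, A.one_mem, 0, A.zero_mem, by rw [zero_mul, add_zero]⟩)

theorem finrank_adjoin_ι_le [DecidableEq V] (S : Finset V) :
    FiniteDimensional k (Subalgebra.toSubmodule (Algebra.adjoin k (ι Q '' (S : Set V)))) ∧
      Module.finrank k (Subalgebra.toSubmodule (Algebra.adjoin k (ι Q '' (S : Set V)))) ≤
        2 ^ S.card := by
  induction S using Finset.induction_on with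
  | empty =>
    rw [Finset.coe_empty, Set.image_empty, Algebra.adjoin_empty, Algebra.toSubmodule_bot,
      Submodule.one_eq_span]
    exact ⟨inferInstance, (finrank_span_le_card _).trans (by simp)⟩
  | insert v S hv ih =>
    obtain ⟨h1, h2⟩ := ih
    rw [Finset.coe_insert, Finset.card_insert_of_notMem hv]
    have hle := adjoin_insert_ι_le Q (S : Set V) v
    set A := Subalgebra.toSubmodule (Algebra.adjoin k (ι Q '' (S : Set V)))
    refine ⟨Submodule.finiteDimensional_of_le hle, ?_⟩
    have h3 := Submodule.finrank_mono hle
    have h4 := Submodule.finrank_add_le_finrank_add_finrank A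
      (A.map (LinearMap.mulRight k (ι Q v)))
    have h5 := Submodule.finrank_map_le (LinearMap.mulRight k (ι Q v)) A
    rw [pow_succ]
    omega

theorem finrank_cliffordAlgebra_le [FiniteDimensional k V] :
    FiniteDimensional k (CliffordAlgebra Q) ∧
      Module.finrank k (CliffordAlgebra Q) ≤ 2 ^ Module.finrank k V := by
  classical
  let b := Module.finBasis k V
  let S : Finset V := Finset.univ.image b
  have hS : Algebra.adjoin k (ι Q '' (S : Set V)) = ⊤ := by
    rw [eq_top_iff, ← adjoin_range_ι, Algebra.adjoin_le_iff]
    rintro _ ⟨x, rfl⟩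
    have hx : x ∈ Submodule.span k (S : Set V) := by
      have : (S : Set V) = Set.range b := by simp [S]
      rw [this, b.span_eq]; trivial
    have h := Submodule.mem_map_of_mem (f := ι Q) hx
    rw [Submodule.map_span] at h
    exact Algebra.span_le_adjoin k _ h
  have hcard : S.card ≤ Module.finrank k V :=
    Finset.card_image_le.trans (by simp)
  obtain ⟨h1, h2⟩ := finrank_adjoin_ι_le Q S
  rw [hS, Algebra.top_toSubmodule] at h1 h2
  refine ⟨Module.Finite.equiv Submodule.topEquiv, ?_⟩
  rw [finrank_top] at h2
  exact h2.trans (Nat.pow_le_pow_right two_pos hcard)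

/-- Multiplication by an anisotropic vector embeds the even part in the odd part, hence the even
part has at most half the dimension of the Clifford algebra. -/
theorem finrank_even_le [FiniteDimensional k V] {x : V} (hx : Q x ≠ 0) :
    FiniteDimensional k (even Q) ∧ 2 * Module.finrank k (even Q) ≤ 2 ^ Module.finrank k V := by
  obtain ⟨h1, h2⟩ := finrank_cliffordAlgebra_le Q
  refine ⟨inferInstanceAs (FiniteDimensional k (Subalgebra.toSubmodule (even Q))), ?_⟩
  have hinj : Function.Injective (LinearMap.mulLeft k (ι Q x)) := by
    intro a b hab
    have h := congrArg (ι Q x * ·) hab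
    simp only [LinearMap.mulLeft_apply, ← mul_assoc, ι_sq_scalar, ← Algebra.smul_def] at h
    exact smul_right_injective _ hx h
  have h3 : Module.finrank k ((evenOdd Q 0).map (LinearMap.mulLeft k (ι Q x))) =
      Module.finrank k (evenOdd Q 0) :=
    ((evenOdd Q 0).equivMapOfInjective _ hinj).finrank_eq.symm
  have h4 : (evenOdd Q 0).map (LinearMap.mulLeft k (ι Q x)) ≤ evenOdd Q 1 := by
    rintro _ ⟨a, ha, rfl⟩
    have := evenOdd_mul_le Q 1 0 (Submodule.mul_mem_mul (ι_mem_evenOdd_one Q x) ha)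
    rwa [add_zero] at this
  have h5 := Submodule.finrank_mono h4
  have h6 := Submodule.finrank_add_eq_of_isCompl (evenOdd_isCompl Q)
  have h7 : Module.finrank k (even Q) = Module.finrank k (evenOdd Q 0) := by
    rw [← even_toSubmodule]; rfl
  omega

end Dimension

/-! ### Uniqueness of the spinor module -/

namespace OctonionAlgebra

open CliffordAlgebra

variable {k : Type u} [Field k] {C : Type v} [AddCommGroup C] [Module k C]
variable {V : Type v} [AddCommGroup V] [Module k V] {Q : QuadraticForm k V}

theorem eq_bot_or_eq_top_of_spinRep_stable (O : OctonionAlgebra k C) (f : Q →qᵢ O.q)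
    (hf : LinearMap.range f.toLinearMap = O.pure) {N : Submodule k C}
    (hN : ∀ g : even Q, ∀ n ∈ N, O.spinRep f g n ∈ N) : N = ⊥ ∨ N = ⊤ := by
  have hf' : ∀ x, f x ∈ O.pure := fun x => hf ▸ ⟨x, rfl⟩
  refine or_iff_not_imp_left.2 fun h0 => O.eq_top_of_stable (fun x hx y hy n hn => ?_) h0
  rw [← hf] at hx hy
  obtain ⟨x, rfl⟩ := hx
  obtain ⟨y, rfl⟩ := hy
  have h := N.neg_mem (hN ((even.ι Q).bilin x y) n hn)
  rwa [O.spinRep_ι_mul_ι f hf', neg_neg] at h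

/-- The even Clifford algebra of the pure octonions maps onto the endomorphisms of `C`: this is the
density theorem for the simple module `C`, whose commutant is `k`. -/
theorem spinRep_surjective (O : OctonionAlgebra k C) (f : Q →qᵢ O.q)
    (hf : LinearMap.range f.toLinearMap = O.pure) : Function.Surjective (O.spinRep f) := by
  have hf' : ∀ x, f x ∈ O.pure := fun x => hf ▸ ⟨x, rfl⟩
  have := O.finiteDimensional
  let _ : Module (even Q) C := Module.compHom C (O.spinRep f).toRingHom
  have hsmul : ∀ (a : even Q) (c : C), a • c = O.spinRep f a c := fun _ _ => rfl
  have hksmul : ∀ (r : k) (c : C), algebraMap k (even Q) r • c = r • c := fun r c => by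
    rw [hsmul, AlgHom.commutes]; rfl
  have : Nontrivial C := ⟨O.e, 0, O.e_ne_zero⟩
  have : IsSimpleModule (even Q) C :=
    { toIsSimpleOrder :=
      { eq_bot_or_eq_top := fun N => by
          let N' : Submodule k C :=
            { N.toAddSubmonoid with
              smul_mem' := fun r c hc => by
                have : r • c ∈ N := by rw [← hksmul]; exact N.smul_mem _ hc
                exact this }
          rcases O.eq_bot_or_eq_top_of_spinRep_stable f hf (N := N')
            (fun g n hn => N.smul_mem g hn) with h | h
          · left
            refine eq_bot_iff.2 fun c hc => ?_
            have : c ∈ N' := hc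
            rw [h] at this
            exact this
          · right
            refine eq_top_iff.2 fun c _ => ?_
            have : c ∈ N' := by rw [h]; trivial
            exact this } }
  intro φ
  have hcomm : ∀ D : Module.End (even Q) C, ∃ c : k, ∀ w, D w = c • w := by
    intro D
    let D' : Module.End k C :=
      { toFun := D
        map_add' := map_add D
        map_smul' := fun r c => by
          rw [← hksmul, map_smul, hksmul]; rfl }
    refine O.exists_eq_smul_of_commute (D := D') fun x hx y hy w => ?_
    rw [← hf] at hx hy
    obtain ⟨x, rfl⟩ := hx
    obtain ⟨y, rfl⟩ := hy
    have h := D.map_smul ((even.ι Q).bilin x y) w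
    rw [hsmul, hsmul, O.spinRep_ι_mul_ι f hf', O.spinRep_ι_mul_ι f hf', map_neg, neg_inj] at h
    exact h
  let F : Module.End (Module.End (even Q) C) C :=
    { toFun := φ
      map_add' := map_add φ
      map_smul' := fun D w => by
        obtain ⟨c, hc⟩ := hcomm D
        change φ (D w) = D (φ w)
        rw [hc, hc, map_smul] }
  classical
  let b := Module.finBasis k C
  obtain ⟨r, hr⟩ := jacobson_density F (Finset.univ.image b)
  exact ⟨r, b.ext fun i => (hr (b i) (by simp)).symm⟩

theorem spinRep_bijective (O : OctonionAlgebra k C) (f : Q →qᵢ O.q)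
    (hf : LinearMap.range f.toLinearMap = O.pure) (hV : Module.finrank k V = 7) :
    Function.Bijective (O.spinRep f) := by
  have := O.finiteDimensional
  have : FiniteDimensional k V := Module.finite_of_finrank_pos (by rw [hV]; norm_num)
  have hsurj := O.spinRep_surjective f hf
  obtain ⟨x, hx, hq, -⟩ := O.exists_q_ne_zero_orthogonal 0 0 0
  rw [← hf] at hx
  obtain ⟨x, rfl⟩ := hx
  have hQx : Q x ≠ 0 := by rw [← f.map_app]; exact hq
  obtain ⟨h1, h2⟩ := finrank_even_le Q hQx
  have h3 : Module.finrank k (Module.End k C) = 64 := by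
    rw [Module.finrank_linearMap, O.finrank_eq]
  have h4 := LinearMap.finrank_le_finrank_of_surjective
    (f := (O.spinRep f).toLinearMap) hsurj
  rw [hV] at h2
  refine ⟨?_, hsurj⟩
  exact (LinearMap.injective_iff_surjective_of_finrank_eq_finrank
    (f := (O.spinRep f).toLinearMap) (by omega)).2 hsurj

/-- Every simple module over the even Clifford algebra is isomorphic to `C`: one of the maps sending
`c` to the action on a vector of the operator of rank one with image `c` is nonzero. -/
theorem exists_equiv_spinRep (O : OctonionAlgebra k C) (f : Q →qᵢ O.q)
    (hf : LinearMap.range f.toLinearMap = O.pure) (hV : Module.finrank k V = 7)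
    (W : Type w) [AddCommGroup W] [Module k W] [Module (even Q) W] [IsScalarTower k (even Q) W]
    [IsSimpleModule (even Q) W] :
    ∃ T : C ≃ₗ[k] W, ∀ (a : even Q) (c : C), T (O.spinRep f a c) = a • T c := by
  have := O.finiteDimensional
  let E : even Q ≃ₐ[k] Module.End k C :=
    AlgEquiv.ofBijective (O.spinRep f) (O.spinRep_bijective f hf hV)
  have hE : ∀ a, E a = O.spinRep f a := fun _ => rfl
  let T : Module.Dual k C → W → C →ₗ[k] W := fun φ w =>
    { toFun := fun c => E.symm (φ.smulRight c) • w
      map_add' := fun c d => by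
        rw [← add_smul, ← map_add]
        congr 2
        ext; simp
      map_smul' := fun r c => by
        rw [RingHom.id_apply, ← smul_assoc, ← map_smul]
        congr 2
        exact LinearMap.ext fun x => smul_comm _ _ _ }
  have hT_apply : ∀ φ w c, T φ w c = E.symm (φ.smulRight c) • w := fun _ _ _ => rfl
  have hT : ∀ φ w (a : even Q) c, T φ w (O.spinRep f a c) = a • T φ w c := by
    intro φ w a c
    rw [hT_apply, hT_apply, smul_smul]
    congr 1
    apply E.injective
    rw [map_mul, E.apply_symm_apply, E.apply_symm_apply, hE]
    ext; simp
  have := IsSimpleModule.nontrivial (even Q) W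
  obtain ⟨w, hw⟩ := exists_ne (0 : W)
  obtain ⟨φ, hφ⟩ : ∃ φ, T φ w ≠ 0 := by
    by_contra! h
    let b := Module.finBasis k C
    have h1 : (1 : even Q) = ∑ i, E.symm ((b.coord i).smulRight (b i)) := by
      apply E.injective
      rw [map_one, map_sum]
      simp only [AlgEquiv.apply_symm_apply]
      refine LinearMap.ext fun c => ?_
      simp [b.sum_repr]
    apply hw
    rw [← one_smul (even Q) w, h1, Finset.sum_smul]
    refine Finset.sum_eq_zero fun i _ => ?_
    rw [← hT_apply, h, LinearMap.zero_apply]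
  have hinj : LinearMap.ker (T φ w) = ⊥ := by
    refine (O.eq_bot_or_eq_top_of_spinRep_stable f hf (N := LinearMap.ker (T φ w))
      fun g n hn => ?_).resolve_right fun h => hφ (LinearMap.ker_eq_top.1 h)
    rw [LinearMap.mem_ker] at hn ⊢
    rw [hT, hn, smul_zero]
  have hsurj : Function.Surjective (T φ w) := by
    let R : Submodule (even Q) W :=
      { (LinearMap.range (T φ w)).toAddSubmonoid with
        smul_mem' := by
          rintro a _ ⟨c, rfl⟩
          exact ⟨O.spinRep f a c, hT φ w a c⟩ }
    rcases eq_bot_or_eq_top R with h | h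
    · exfalso
      apply hφ
      ext c
      have : T φ w c ∈ R := ⟨c, rfl⟩
      rw [h] at this
      exact this
    · intro x
      have : x ∈ R := by rw [h]; trivial
      exact this
  exact ⟨LinearEquiv.ofBijective (T φ w) ⟨LinearMap.ker_eq_bot.1 hinj, hsurj⟩, hT φ w⟩

end OctonionAlgebra

theorem isSemisimpleRepresentation_of_equiv {k G W U : Type*} [Field k] [Monoid G] [AddCommGroup W]
    [Module k W] [AddCommGroup U] [Module k U] {ρ : Representation k G W}
    {π : Representation k G U} (T : W ≃ₗ[k] U) (hT : ∀ g w, T (ρ g w) = π g (T w))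
    (h : π.IsSemisimpleRepresentation) : ρ.IsSemisimpleRepresentation := by
  have hT' : ∀ g u, T.symm (π g u) = ρ g (T.symm u) := fun g u => by
    rw [T.symm_apply_eq, hT, T.apply_symm_apply]
  let e : Subrepresentation ρ ≃o Subrepresentation π :=
    { toFun := fun N => ⟨N.toSubmodule.comap T.symm.toLinearMap, fun g u hu => by
        change T.symm (π g u) ∈ N.toSubmodule
        rw [hT']
        exact N.apply_mem_toSubmodule g hu⟩
      invFun := fun N => ⟨N.toSubmodule.comap T.toLinearMap, fun g u hu => by
        change T (ρ g u) ∈ N.toSubmodule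
        rw [hT]
        exact N.apply_mem_toSubmodule g hu⟩
      left_inv := fun N => by
        ext u
        change T.symm (T u) ∈ N.toSubmodule ↔ _
        rw [T.symm_apply_apply]
      right_inv := fun N => by
        ext u
        change T (T.symm u) ∈ N.toSubmodule ↔ _
        rw [T.apply_symm_apply]
      map_rel_iff' := fun {N N'} => by
        constructor
        · intro h u hu
          have := @h (T u) (by change T.symm (T u) ∈ N.toSubmodule; rwa [T.symm_apply_apply])
          change T.symm (T u) ∈ N'.toSubmodule at this
          rwa [T.symm_apply_apply] at this
        · intro h u hu
          exact h hu }
  exact e.complementedLattice_iff.2 h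

/-! ### Subgroups contained in a `G₂`-subgroup -/

namespace OctonionAlgebra

open CliffordAlgebra

variable {k : Type u} [Field k] {C : Type v} [AddCommGroup C] [Module k C]
variable {V : Type v} [AddCommGroup V] [Module k V] {Q : QuadraticForm k V}

/-- Twisting the embedding of `V` in `C` by the vector representation of `g` conjugates the spinor
representation by `g`. -/
theorem exists_isometry_conj (O : OctonionAlgebra k C) (f : Q →qᵢ O.q)
    (hinj : Function.Injective f) (hf : LinearMap.range f.toLinearMap = O.pure) {g : (even Q)ˣ}
    (hg : g ∈ GSpinGroup Q) :
    ∃ f' : Q →qᵢ O.q, Function.Injective f' ∧ LinearMap.range f'.toLinearMap = O.pure ∧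
      ∀ γ : even Q, O.spinRep f' γ =
        O.spinRep f g * O.spinRep f γ * O.spinRep f (g⁻¹ : (even Q)ˣ) := by
  have hf' : ∀ x, f x ∈ O.pure := fun x => hf ▸ ⟨x, rfl⟩
  set T := O.spinRep f g with hT
  set T' := O.spinRep f (g⁻¹ : (even Q)ˣ) with hT'
  have e1 : ∀ w, T (T' w) = w := O.spinRep_apply_inv_apply f g
  have e2 : ∀ w, T' (T w) = w := O.spinRep_inv_apply_apply f g
  let F : V →ₗ[k] C := T ∘ₗ O.mul.flip (T' O.e) ∘ₗ f.toLinearMap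
  have hF_apply : ∀ x, F x = T (O.mul (f x) (T' O.e)) := fun _ => rfl
  have hF : ∀ x, F x ∈ O.pure ∧ ∀ b, T (O.mul (f x) b) = O.mul (F x) (T b) := by
    intro x
    obtain ⟨y, hy, h⟩ := O.normalizesPure_spinRep f hf hg (f x) (hf' x)
    have : F x = y := by rw [hF_apply, h, e1, O.mul_e]
    rw [this]
    exact ⟨hy, h⟩
  have hFinj : Function.Injective F := by
    intro x y hxy
    apply hinj
    rw [← O.mul_e (f x), ← O.mul_e (f y), ← e2 (O.mul (f x) O.e), ← e2 (O.mul (f y) O.e),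
      (hF x).2, (hF y).2, hxy]
  have hFq : ∀ x, O.q (F x) = Q x := by
    intro x
    have h := (hF x).2 (O.mul (f x) (T' O.e))
    rw [O.pure_mul_mul_self (hf' x), map_neg, map_smul, e1, ← hF_apply] at h
    have h2 := O.pure_mul_mul_self (hF x).1 O.e
    rw [O.mul_e, ← h, neg_inj] at h2
    rw [← f.map_app]
    exact (smul_left_injective k O.e_ne_zero h2).symm
  let f' : Q →qᵢ O.q := { toLinearMap := F, map_app' := hFq }
  have hf'_apply : ∀ x, f' x = F x := fun _ => rfl
  have hle : LinearMap.range F ≤ O.pure := by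
    rintro _ ⟨x, rfl⟩
    exact (hF x).1
  have := O.finiteDimensional
  have hrange : LinearMap.range F = O.pure := by
    refine Submodule.eq_of_le_of_finrank_eq hle ?_
    rw [LinearMap.finrank_range_of_inj hFinj, ← hf, LinearMap.finrank_range_of_inj hinj]
  refine ⟨f', hFinj, hrange, fun γ => ?_⟩
  let E : C ≃ₗ[k] C := LinearEquiv.ofLinearMap T T' (O.spinRep_mul_inv f g) (O.spinRep_inv_mul f g)
  have hEE : O.spinRep f' = (E.conjAlgEquiv k).toAlgHom.comp (O.spinRep f) := by
    refine even.algHom_ext Q (EvenHom.ext (LinearMap.ext fun x => LinearMap.ext fun y =>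
      LinearMap.ext fun c => ?_))
    change O.spinRep f' ((even.ι Q).bilin x y) c = T (O.spinRep f ((even.ι Q).bilin x y) (T' c))
    rw [O.spinRep_ι_mul_ι f' (fun x => (hF x).1), O.spinRep_ι_mul_ι f hf', map_neg, (hF x).2,
      (hF y).2, e1]
    rfl
  rw [hEE]
  rfl

/-- The characterization of the subgroups of `Spin(P)` contained in a `G₂`-subgroup. -/
theorem tfae_le_isG2Subgroup (hV : Module.finrank k V = 7)
    (hG2 : ∃ H : Subgroup (even Q)ˣ, IsG2Subgroup Q H)
    (W : Type w) [AddCommGroup W] [Module k W] [Module (even Q) W] [IsScalarTower k (even Q) W]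
    [IsSimpleModule (even Q) W] (Γ : Subgroup (even Q)ˣ) (hΓ : Γ ≤ SpinGroup Q)
    (hss : (cliffordUnitsRep (Algebra.lsmul k k W) Γ).IsSemisimpleRepresentation) :
    List.TFAE
      [ ∀ γ ∈ Γ, ∃ H : Subgroup (even Q)ˣ, IsG2Subgroup Q H ∧ γ ∈ H,
        ∀ γ ∈ Γ, Module.End.HasEigenvalue (Algebra.lsmul k k W (γ : even Q)) 1,
        ∃ H : Subgroup (even Q)ˣ, IsG2Subgroup Q H ∧ Γ ≤ H ] := by
  tfae_have 1 → 2 := by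
    intro h γ hγ
    obtain ⟨_, ⟨D, _, _, O, f, -, hf, rfl⟩, hmem⟩ := h γ hγ
    obtain ⟨T, hT⟩ := O.exists_equiv_spinRep f hf hV W
    refine hasEigenvalue_one_iff.2 ⟨T O.e, fun h0 => O.e_ne_zero (T.map_eq_zero_iff.1 h0), ?_⟩
    change (γ : even Q) • T O.e = T O.e
    rw [← hT, (O.mem_g2Image f hf hmem.1).1 hmem]
  tfae_have 2 → 3 := by
    intro h
    obtain ⟨_, D, _, _, O, f, hinj, hf, -⟩ := hG2
    obtain ⟨T, hT⟩ := O.exists_equiv_spinRep f hf hV W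
    have hss' := isSemisimpleRepresentation_of_equiv
      (ρ := cliffordUnitsRep (O.spinRep f) Γ) T (fun g c => hT _ c) hss
    obtain ⟨s, hs, hfix⟩ := O.exists_fixed_of_forall_hasEigenvalue f hf hΓ hss' fun γ hγ => by
      obtain ⟨w, hw, hγw⟩ := hasEigenvalue_one_iff.1 (h γ hγ)
      refine hasEigenvalue_one_iff.2
        ⟨T.symm w, fun h0 => hw (T.symm.map_eq_zero_iff.1 h0), T.injective ?_⟩
      rw [hT, T.apply_symm_apply]
      exact hγw
    obtain ⟨g, hg, hgs, -⟩ := O.exists_conj_mem_g2Image f hf hs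
    obtain ⟨f', hinj', hf', hconj⟩ := O.exists_isometry_conj f hinj hf hg
    refine ⟨O.g2Image f', ⟨D, _, _, O, f', hinj', hf', rfl⟩, fun γ hγ => ?_⟩
    rw [O.mem_g2Image f' hf' (hΓ hγ), hconj, Module.End.mul_apply, Module.End.mul_apply, ← hgs,
      spinRep_inv_apply_apply, hfix γ hγ]
  tfae_have 3 → 1 := by
    rintro ⟨H, hH, hle⟩ γ hγ
    exact ⟨H, hH, hle hγ⟩
  tfae_finish

end OctonionAlgebra

theorem mainTheorem3 (k : Type u) [Field k] :
    (∀ (C : Type v) [AddCommGroup C] [Module k C] (O : OctonionAlgebra k C)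
      (Γ : Subgroup (CliffordAlgebra.even O.pureForm)ˣ),
      Γ ≤ SpinGroup O.pureForm →
      (cliffordUnitsRep (O.spinRep O.pureIncl) Γ).IsSemisimpleRepresentation →
      List.TFAE
        [ ∀ γ ∈ Γ, ∃ g ∈ GSpinGroup O.pureForm, g * γ * g⁻¹ ∈ O.g2Image O.pureIncl,
          ∀ γ ∈ Γ, ∃ s : C, O.q s ≠ 0 ∧ O.spinRep O.pureIncl γ s = s,
          ∀ γ ∈ Γ, Module.End.HasEigenvalue (O.spinRep O.pureIncl γ) 1,
          ∃ g ∈ GSpinGroup O.pureForm, ∀ γ ∈ Γ, g * γ * g⁻¹ ∈ O.g2Image O.pureIncl,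
          ∃ s : C, O.q s ≠ 0 ∧ ∀ γ ∈ Γ, O.spinRep O.pureIncl γ s = s ]) ∧
    (∀ (P : Type v) [AddCommGroup P] [Module k P] (Q : QuadraticForm k P),
      IsRegularQuadraticForm Q → Module.finrank k P = 7 →
      (∃ H : Subgroup (CliffordAlgebra.even Q)ˣ, IsG2Subgroup Q H) →
      ∀ (W : Type w) [AddCommGroup W] [Module k W] [Module (CliffordAlgebra.even Q) W]
        [IsScalarTower k (CliffordAlgebra.even Q) W] [IsSimpleModule (CliffordAlgebra.even Q) W]
        (Γ : Subgroup (CliffordAlgebra.even Q)ˣ),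
      Γ ≤ SpinGroup Q →
      (cliffordUnitsRep (Algebra.lsmul k k W) Γ).IsSemisimpleRepresentation →
      List.TFAE
        [ ∀ γ ∈ Γ, ∃ H : Subgroup (CliffordAlgebra.even Q)ˣ, IsG2Subgroup Q H ∧ γ ∈ H,
          ∀ γ ∈ Γ, Module.End.HasEigenvalue
            (Algebra.lsmul k k W (γ : CliffordAlgebra.even Q)) 1,
          ∃ H : Subgroup (CliffordAlgebra.even Q)ˣ, IsG2Subgroup Q H ∧ Γ ≤ H ]) := by
  refine ⟨fun C _ _ O Γ hΓ hss => O.tfae_conj_g2Image Γ hΓ hss, ?_⟩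
  intro P _ _ Q _ hP hG2 W _ _ _ _ _ Γ hΓ hss
  exact OctonionAlgebra.tfae_le_isG2Subgroup hP hG2 W Γ hΓ hss
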